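/- \textbf{Definitions.} A \emph{model strip} is a subset $S\subset\mathbb{R}\times[-1,1]$ that contains $\mathbb{R}\times(-1,1)$ and for which $S\cap(\mathbb{R}\times\{-1,1\})$ is a (possibly empty, possibly infinite) union of nonempty bounded open intervals with mutually disjoint closures. Put $\partial_{-}S=S\cap(\mathbb{R}\times\{-1\})$ and $\partial_{+}S=S\cap(\mathbb{R}\times\{1\})$; the connected components of $\partial_-S$ and of $\partial_+S$ are the \emph{boundary intervals} of $S$. The \emph{leaves} of $S$ are the lines $\mathbb{R}\times\{t\}$, $t\in(-1,1)$, and the boundary intervals. A \emph{stripped surface} is a quotient space $$Z=\bigsqcup_{\alpha\in A}S_\alpha\Big/\{Y_\beta\overset{\phi_\beta}{\sim}X_\beta\}_{\beta\in B},$$ with the quotient topology, where the $S_\alpha$ are model strips, $X_\beta,Y_\beta$ ($\beta\in B$) are pairwise distinct boundary intervals of these strips (so that each boundary interval is glued to at most one other), and $\phi_\beta:Y_\beta\to X_\beta$ are affine homeomorphisms, preserving or reversing orientation. The \emph{leaves} of $Z$ are the images in $Z$ of the leaves of the strips $S_\alpha$. A homeomorphism between stripped surfaces is an \emph{$\mathcal{F}$-homeomorphism}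 if it maps leaves onto leaves. Let $\omega$ be the leaf that is the common image of $X_\beta$ and $Y_\beta$, where $X_\beta\subset\partial_\varepsilon S_\gamma$ and $Y_\beta\subset\partial_{\varepsilon'}S_{\gamma'}$ with $\varepsilon,\varepsilon'\in\{-,+\}$. The leaf $\omega$ is of \emph{type (c1)} if $\gamma=\gamma'$, $X_\beta=\partial_\varepsilon S_\gamma$ and $Y_\beta=\partial_{\varepsilon'}S_{\gamma}$; it is of \emph{type (c2)} if $\gamma\ne\gamma'$, $X_\beta=\partial_\varepsilon S_\gamma$ and $Y_\beta=\partial_{\varepsilon'}S_{\gamma'}$. A stripped surface is \emph{reduced} if it has no leaves of types (c1) and (c2). Let $S$ be the model strip with $\partial_-S=(-2,2)\times\{-1\}$ and $\partial_+S=(-2,2)\times\{1\}$. The open cylinder $C$ and the open M\"obius band $M$ are the stripped surfaces obtained from $S$ by gluing $\partial_+S$ to $\partial_-S$ via $t\mapsto t$ and via $t\mapsto -t$, respectively. \textbf{Theorem.} Every connected stripped surface $Z$ with countable base is $\mathcal{F}$-homeomorphic either to the cylinder $C$, or to the M\"obius band $M$, or to a reduced stripped surface. -/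

import Mathlib

open Set

universe u v

/-- The two sides of the closed band `ℝ × [-1, 1]`. -/
inductive Side : Type
  | lower
  | upper

/-- The height of a side: `-1` for the lower one and `1` for the upper one. -/
def Side.level : Side → ℝ
  | Side.lower => -1
  | Side.upper => 1

/-- A model strip: `ℝ × (-1, 1)` together with, on each of the lines `ℝ × {-1}` and `ℝ × {1}`, a
(possibly empty, possibly infinite) union of nonempty bounded open intervals with mutually
disjoint closures.  An interval is recorded by the pair of its end points.  As the intervals on
each side are open and disjoint, they are exactly the connected components of the part of the strip
on that side, so the strip as a subset of the plane determines this data. -/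
structure ModelStrip where
  /-- the intervals `(p.1, p.2)` lying on each side -/
  intervals : Side → Set (ℝ × ℝ)
  lt : ∀ e, ∀ p ∈ intervals e, p.1 < p.2
  disjoint : ∀ e, (intervals e).PairwiseDisjoint (fun p => Icc p.1 p.2)

namespace ModelStrip

/-- The part of the strip on the side `e`, i.e. `∂₋S` or `∂₊S`. -/
def boundary (S : ModelStrip) (e : Side) : Set (ℝ × ℝ) :=
  {z | z.2 = e.level ∧ ∃ p ∈ S.intervals e, z.1 ∈ Ioo p.1 p.2}

/-- The strip as a subset of the plane. -/
def carrier (S : ModelStrip) : Set (ℝ × ℝ) :=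
  {z | z.2 ∈ Ioo (-1 : ℝ) 1} ∪ ⋃ e, S.boundary e

/-- A boundary interval of the strip: a connected component of `∂₋S` or of `∂₊S`. -/
structure BoundaryInterval (S : ModelStrip) where
  side : Side
  ends : ℝ × ℝ
  mem : ends ∈ S.intervals side

/-- A boundary interval as a subset of the plane. -/
def BoundaryInterval.toSet {S : ModelStrip} (I : S.BoundaryInterval) : Set (ℝ × ℝ) :=
  Ioo I.ends.1 I.ends.2 ×ˢ {I.side.level}

/-- The leaves of the foliation of the strip: the lines `ℝ × {t}` with `-1 < t < 1`, and the
boundary intervals. -/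
def leaves (S : ModelStrip) : Set (Set (ℝ × ℝ)) :=
  {l | (∃ t ∈ Ioo (-1 : ℝ) 1, l = univ ×ˢ {t}) ∨ ∃ I : S.BoundaryInterval, l = I.toSet}

end ModelStrip

/-- A stripped surface: a family of model strips, with some disjoint pairs of distinct boundary
intervals `Y b`, `X b` to be identified by affine homeomorphisms `Y b → X b`.
An affine homeomorphism of bounded open intervals is the restriction of a unique affine
automorphism of the line, which is what `φ b` is. -/
structure StrippedSurface where
  /-- the index set of the strips -/
  A : Type u
  /-- the index set of the gluings -/
  B : Type v
  strip : A → ModelStrip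
  X : B → Σ a, (strip a).BoundaryInterval
  Y : B → Σ a, (strip a).BoundaryInterval
  X_injective : Function.Injective X
  Y_injective : Function.Injective Y
  X_ne_Y : ∀ b b', X b ≠ Y b'
  φ : B → ℝ ≃ᵃ[ℝ] ℝ
  φ_image : ∀ b, φ b '' Ioo (Y b).2.ends.1 (Y b).2.ends.2 = Ioo (X b).2.ends.1 (X b).2.ends.2

namespace StrippedSurface

/-- The disjoint union of the strips, with the disjoint union topology. -/
abbrev Total (Z : StrippedSurface.{u, v}) : Type u :=
  Σ a, (Z.strip a).carrier

/-- A point `z` of some `Y b` is to be identified with its image `w` in `X b`. -/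
def Glue (Z : StrippedSurface.{u, v}) (z w : Z.Total) : Prop :=
  ∃ b : Z.B, z.1 = (Z.Y b).1 ∧ (z.2 : ℝ × ℝ) ∈ (Z.Y b).2.toSet ∧
    w.1 = (Z.X b).1 ∧ (w.2 : ℝ × ℝ) = (Z.φ b (z.2 : ℝ × ℝ).1, (Z.X b).2.side.level)

/-- The underlying topological space: the quotient of the disjoint union of the strips by the
equivalence relation generated by the gluing, with the quotient topology. -/
abbrev Space (Z : StrippedSurface.{u, v}) : Type u :=
  Quot Z.Glue

/-- The chart map of a strip. -/
def chart (Z : StrippedSurface.{u, v}) (a : Z.A) (z : (Z.strip a).carrier) : Z.Space :=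
  Quot.mk Z.Glue ⟨a, z⟩

/-- The image in the surface of (the part in the strip `a` of) a subset of the plane. -/
def image (Z : StrippedSurface.{u, v}) (a : Z.A) (l : Set (ℝ × ℝ)) : Set Z.Space :=
  Z.chart a '' (Subtype.val ⁻¹' l)

/-- The leaves of the canonical foliation: the images of the leaves of the strips. -/
def leaves (Z : StrippedSurface.{u, v}) : Set (Set Z.Space) :=
  {w | ∃ a, ∃ l ∈ (Z.strip a).leaves, w = Z.image a l}

/-- A leaf of type (c1): two boundary intervals of one and the same strip are glued together, and
each of them is the whole of its side of that strip. -/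
def IsTypeC1 (Z : StrippedSurface.{u, v}) (w : Set Z.Space) : Prop :=
  ∃ b : Z.B, w = Z.image (Z.X b).1 (Z.X b).2.toSet ∧ (Z.X b).1 = (Z.Y b).1 ∧
    (Z.X b).2.toSet = (Z.strip (Z.X b).1).boundary (Z.X b).2.side ∧
    (Z.Y b).2.toSet = (Z.strip (Z.Y b).1).boundary (Z.Y b).2.side

/-- A leaf of type (c2): boundary intervals of two distinct strips are glued together, and each of
them is the whole of its side of its strip. -/
def IsTypeC2 (Z : StrippedSurface.{u, v}) (w : Set Z.Space) : Prop :=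
  ∃ b : Z.B, w = Z.image (Z.X b).1 (Z.X b).2.toSet ∧ (Z.X b).1 ≠ (Z.Y b).1 ∧
    (Z.X b).2.toSet = (Z.strip (Z.X b).1).boundary (Z.X b).2.side ∧
    (Z.Y b).2.toSet = (Z.strip (Z.Y b).1).boundary (Z.Y b).2.side

/-- A stripped surface is reduced if it has no leaves of types (c1) and (c2). -/
def IsReduced (Z : StrippedSurface.{u, v}) : Prop :=
  ∀ w ∈ Z.leaves, ¬ Z.IsTypeC1 w ∧ ¬ Z.IsTypeC2 w

/-- There is a homeomorphism that maps leaves onto leaves. -/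
def FHomeomorphic.{u₁, v₁, u₂, v₂} (Z : StrippedSurface.{u₁, v₁})
    (Z' : StrippedSurface.{u₂, v₂}) : Prop :=
  ∃ h : Z.Space ≃ₜ Z'.Space, ∀ w ∈ Z.leaves, h '' w ∈ Z'.leaves

end StrippedSurface

/-- The model strip whose lower and upper sides are both the single interval `(-2, 2)`. -/
def rectangleStrip : ModelStrip where
  intervals := fun _ => {(-2, 2)}
  lt := by
    intro e p hp
    rw [mem_singleton_iff] at hp
    subst hp
    norm_num
  disjoint := fun _ => pairwiseDisjoint_singleton _ _

/-- The only boundary interval of `rectangleStrip` on the side `e`. -/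
def rectangleSide (e : Side) : rectangleStrip.BoundaryInterval where
  side := e
  ends := (-2, 2)
  mem := rfl

/-- The surface obtained from `rectangleStrip` by gluing its upper side to its lower side along an
affine map. -/
def rectangleGlue (f : ℝ ≃ᵃ[ℝ] ℝ) (hf : f '' Ioo (-2) 2 = Ioo (-2) 2) :
    StrippedSurface.{0, 0} where
  A := Unit
  B := Unit
  strip := fun _ => rectangleStrip
  X := fun _ => ⟨(), rectangleSide Side.lower⟩
  Y := fun _ => ⟨(), rectangleSide Side.upper⟩
  X_injective := fun _ _ _ => rfl
  Y_injective := fun _ _ _ => rfl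
  X_ne_Y := by
    intro _ _ h
    have h' := congrArg (fun I : (Σ _ : Unit, rectangleStrip.BoundaryInterval) => I.2.side) h
    exact Side.noConfusion h'
  φ := fun _ => f
  φ_image := fun _ => hf

/-- The open cylinder `C`, with the gluing map `t ↦ t`. -/
def cylinderC : StrippedSurface.{0, 0} :=
  rectangleGlue (AffineEquiv.refl ℝ ℝ) (by simp)

/-- The open Möbius band `M`, with the gluing map `t ↦ -t`. -/
def moebiusM : StrippedSurface.{0, 0} :=
  rectangleGlue (LinearEquiv.neg ℝ).toAffineEquiv (by
    change (fun t : ℝ => -t) '' Ioo (-2) 2 = Ioo (-2) 2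
    simp)

/-!
A leaf of type (c2) is a line along which two different strips are glued along the whole of their
sides, so the strips at such leaves form chains: every strip has at most two neighbours of this
kind.  A chain that does not close up is again a strip.  The idea is to replace all chains by single
strips at once.

Finite and infinite chains are treated together by *placements*: a strip of a chain is put into an
infinite pile of strips of height `2`, at some height, possibly turned upside down or reflected.  A
set `D` of gluings of full boundary intervals is consistent if placements can be chosen such that
each gluing in `D` joins strips that are adjacent in the pile in the corresponding way; such
placements exclude chains that close up.  By Zorn's lemma there is a maximal consistent set
(`exists_isCompatible_forall_eqvGen`).  It connects the two strips of every gluing of full boundary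
intervals, also if the gluing itself is left out because it closes up a chain.

The surface `ChainDatum.merged` has one strip for each chain.  A strip is moved to its band in the
strip of its chain in two steps.  First its sides that are glued within the chain, which are bounded
intervals, are stretched to whole lines, by the inverse of the map `spread`, which is an open
embedding because it is strictly increasing on horizontal lines.  The parametrizations of the
intervals are chosen such that the affine gluing maps become `x ↦ x` or `x ↦ -x`.  Then the pile is
squashed to `ℝ × (-1, 1)`, except that a side at the end of the chain is moved to the boundary
(`toChain`).  The bands form a locally finite closed cover, so the resulting map `merge` is closed,
and it induces a homeomorphism of the quotients (`ChainDatum.fHomeomorphic_merged`).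

By maximality, a gluing of full boundary intervals in the merged surface joins two sides of one
strip.  If there is none, the merged surface is reduced.  If there is one, this strip is open and
closed in the surface, so by connectedness it is the only one, and the surface is the cylinder or
the Möbius band (`fHomeomorphic_cylinderC_or_moebiusM`).
-/

/-! ### Homeomorphisms of the plane that preserve horizontal lines -/

/-- An increasing homeomorphism of the line onto `(-1, 1)`; only its being odd, continuous and
strictly increasing matters. -/
noncomputable def squash (x : ℝ) : ℝ := 2 / Real.pi * Real.arctan x

theorem continuous_squash : Continuous squash :=
  continuous_const.mul Real.continuous_arctan

theorem squash_strictMono : StrictMono squash := fun _ _ h =>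
  mul_lt_mul_of_pos_left (Real.arctan_strictMono h) (by positivity)

theorem squash_neg (x : ℝ) : squash (-x) = -squash x := by
  simp [squash, Real.arctan_neg]

theorem squash_mem (x : ℝ) : squash x ∈ Ioo (-1 : ℝ) 1 := by
  have hpi := Real.pi_pos
  have h1 := Real.neg_pi_div_two_lt_arctan x
  have h2 := Real.arctan_lt_pi_div_two x
  have hc : (0 : ℝ) < 2 / Real.pi := by positivity
  have h3 : 2 / Real.pi * (Real.pi / 2) = 1 := by field_simp
  unfold squash
  constructor <;> nlinarith

theorem exists_squash_eq {y : ℝ} (hy : y ∈ Ioo (-1 : ℝ) 1) : ∃ x, squash x = y := by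
  have hpi := Real.pi_pos
  refine ⟨Real.tan (Real.pi / 2 * y), ?_⟩
  unfold squash
  rw [Real.arctan_tan (by nlinarith [hy.1]) (by nlinarith [hy.2])]
  field_simp

/-- The increasing homeomorphism of the line onto the interval `(p.1, p.2)` obtained from `squash`
by an affine map.  As `squash` is odd, affine bijections between intervals turn these
parametrizations into each other, up to a sign of the variable. -/
noncomputable def stretch (p : ℝ × ℝ) (x : ℝ) : ℝ :=
  (p.1 + p.2) / 2 + (p.2 - p.1) / 2 * squash x

theorem continuous_stretch (p : ℝ × ℝ) : Continuous (stretch p) :=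
  continuous_const.add (continuous_const.mul continuous_squash)

theorem stretch_strictMono {p : ℝ × ℝ} (hp : p.1 < p.2) : StrictMono (stretch p) := by
  intro x y h
  have := mul_lt_mul_of_pos_left (squash_strictMono h) (show 0 < (p.2 - p.1) / 2 by linarith)
  unfold stretch
  linarith

theorem stretch_mem {p : ℝ × ℝ} (hp : p.1 < p.2) (x : ℝ) : stretch p x ∈ Ioo p.1 p.2 := by
  have h := squash_mem x
  unfold stretch
  constructor <;> nlinarith [h.1, h.2]

theorem exists_stretch_eq {p : ℝ × ℝ} {y : ℝ} (hy : y ∈ Ioo p.1 p.2) :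
    ∃ x, stretch p x = y := by
  have hp : 0 < p.2 - p.1 := by linarith [hy.1, hy.2]
  obtain ⟨x, hx⟩ := exists_squash_eq (y := (y - (p.1 + p.2) / 2) / ((p.2 - p.1) / 2))
    ⟨by rw [lt_div_iff₀ (by linarith)]; linarith [hy.1],
      by rw [div_lt_iff₀ (by linarith)]; linarith [hy.2]⟩
  refine ⟨x, ?_⟩
  unfold stretch
  rw [hx, mul_div_cancel₀ _ (by linarith)]
  ring

/-- The sign of the slope of an affine automorphism of the line. -/
noncomputable def affineSign (φ : ℝ ≃ᵃ[ℝ] ℝ) : ℤˣ := if 0 < φ.linear 1 then 1 else -1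

theorem affineEquiv_apply_eq (φ : ℝ ≃ᵃ[ℝ] ℝ) (x y : ℝ) :
    φ x = φ y + φ.linear 1 * (x - y) := by
  have h := φ.map_vadd y (x - y)
  have h2 : φ.linear (x - y) = (x - y) * φ.linear 1 := by
    have := φ.linear.map_smul (x - y) 1
    simpa using this
  simp only [vadd_eq_add, sub_add_cancel] at h
  rw [h, h2]
  ring

theorem affineEquiv_linear_ne_zero (φ : ℝ ≃ᵃ[ℝ] ℝ) : φ.linear 1 ≠ 0 := by
  intro h
  have := φ.linear.map_eq_zero_iff.mp h
  exact one_ne_zero this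

theorem eq_of_Ioo_eq_Ioo {a b c d : ℝ} (hab : a < b) (h : Ioo a b = Ioo c d) :
    a = c ∧ b = d := by
  have hcd : c < d := nonempty_Ioo.mp (h ▸ nonempty_Ioo.mpr hab)
  constructor
  · rw [← csInf_Ioo hab, h, csInf_Ioo hcd]
  · rw [← csSup_Ioo hab, h, csSup_Ioo hcd]

/-- An affine bijection between bounded open intervals is determined by its sign. -/
theorem affineEquiv_eq_of_image_Ioo {φ : ℝ ≃ᵃ[ℝ] ℝ} {p q : ℝ × ℝ} (hp : p.1 < p.2)
    (h : φ '' Ioo p.1 p.2 = Ioo q.1 q.2) (x : ℝ) :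
    φ x = (q.1 + q.2) / 2
      + (affineSign φ : ℤ) * ((q.2 - q.1) / (p.2 - p.1) * (x - (p.1 + p.2) / 2)) := by
  set m := φ.linear 1 with hm
  have hφ : (φ : ℝ → ℝ) = fun x => m * x + φ 0 := by
    funext x
    rw [affineEquiv_apply_eq φ x 0]
    ring
  have hpq : p.2 - p.1 ≠ 0 := by linarith
  have h' := h
  rw [hφ] at h'
  rw [congrFun hφ x]
  rcases lt_or_gt_of_ne (affineEquiv_linear_ne_zero φ) with hneg | hpos
  · have hs : affineSign φ = -1 := if_neg (not_lt.mpr hneg.le)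
    have h2 := congrArg (fun s => (fun t : ℝ => -t) '' s) h'
    simp only [image_image] at h2
    have h3 : (fun x => -(m * x + φ 0)) = fun x => (-m) * x + -φ 0 := by
      funext x
      ring
    rw [h3, image_affine_Ioo (by linarith)] at h2
    simp only [image_neg_eq_neg, Set.neg_Ioo] at h2
    obtain ⟨h4, h5⟩ := eq_of_Ioo_eq_Ioo (by nlinarith) h2
    have h6 : q.2 - q.1 = -m * (p.2 - p.1) := by linarith
    rw [hs, h6, mul_div_cancel_right₀ _ hpq]
    push_cast
    linarith
  · have hs : affineSign φ = 1 := if_pos hpos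
    rw [image_affine_Ioo hpos] at h'
    obtain ⟨h4, h5⟩ := eq_of_Ioo_eq_Ioo (by nlinarith) h'
    have h6 : q.2 - q.1 = m * (p.2 - p.1) := by linarith
    rw [hs, h6, mul_div_cancel_right₀ _ hpq]
    push_cast
    linarith

theorem affineEquiv_stretch {φ : ℝ ≃ᵃ[ℝ] ℝ} {p q : ℝ × ℝ} (hp : p.1 < p.2)
    (h : φ '' Ioo p.1 p.2 = Ioo q.1 q.2) (x : ℝ) :
    φ (stretch p x) = stretch q ((affineSign φ : ℤ) * x) := by
  have hpq : p.2 - p.1 ≠ 0 := by linarith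
  rw [affineEquiv_eq_of_image_Ioo hp h]
  rcases Int.units_eq_one_or (affineSign φ) with hs | hs <;> rw [hs] <;> unfold stretch <;>
    push_cast
  · rw [one_mul, one_mul]
    field_simp
    ring
  · rw [neg_one_mul, neg_one_mul, squash_neg]
    field_simp
    ring

/-- A continuous map of the plane that preserves each horizontal line and is strictly increasing on
it is open: a point between two others on its line stays between them on all nearby lines. -/
theorem isOpenEmbedding_of_strictMono {H : ℝ × ℝ → ℝ} (hc : Continuous H)
    (hm : ∀ t, StrictMono fun x => H (x, t)) :
    Topology.IsOpenEmbedding fun z : ℝ × ℝ => (H z, z.2) := by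
  refine .of_continuous_injective_isOpenMap (hc.prodMk continuous_snd) ?_ ?_
  · rintro ⟨x, t⟩ ⟨y, t'⟩ h
    obtain ⟨h1, rfl⟩ := Prod.mk.inj h
    rw [(hm t).injective h1]
  · rw [isOpenMap_iff_nhds_le]
    rintro ⟨x, t⟩
    intro s hs
    rw [Filter.mem_map, nhds_prod_eq, Filter.mem_prod_iff] at hs
    obtain ⟨U, hU, V, hV, hUV⟩ := hs
    obtain ⟨l, r, hx, hlr⟩ := mem_nhds_iff_exists_Ioo_subset.mp hU
    obtain ⟨a, hla, hax⟩ := exists_between hx.1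
    obtain ⟨b, hxb, hbr⟩ := exists_between hx.2
    have hW : {z : ℝ × ℝ | H (a, z.2) < z.1 ∧ z.1 < H (b, z.2)} ∈ nhds (H (x, t), t) := by
      refine IsOpen.mem_nhds ?_ ⟨hm t hax, hm t hxb⟩
      have ha : Continuous fun z : ℝ × ℝ => H (a, z.2) := by fun_prop
      have hb : Continuous fun z : ℝ × ℝ => H (b, z.2) := by fun_prop
      exact (isOpen_lt ha continuous_fst).inter (isOpen_lt continuous_fst hb)
    have hV' : {z : ℝ × ℝ | z.2 ∈ V} ∈ nhds (H (x, t), t) :=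
      continuous_snd.continuousAt.preimage_mem_nhds hV
    filter_upwards [hW, hV'] with ⟨y, t'⟩ h1 h2
    have hcont : ContinuousOn (fun x => H (x, t')) (Icc a b) := by fun_prop
    obtain ⟨c, hc1, hc2⟩ := intermediate_value_Ioo (hax.trans hxb).le hcont h1
    have := hUV (show (c, t') ∈ U ×ˢ V from ⟨hlr ⟨hla.trans hc1.1, hc1.2.trans hbr⟩, h2⟩)
    rw [mem_preimage] at this
    simpa only [hc2] using this

/-- The piecewise linear function that is `0` on `(-∞, 0]`, the identity on `[0, 1]` and `1` on
`[1, ∞)`. -/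
def ramp (t : ℝ) : ℝ := max 0 (min t 1)

theorem continuous_ramp : Continuous ramp := by
  unfold ramp
  fun_prop

theorem ramp_nonneg (t : ℝ) : 0 ≤ ramp t := le_max_left _ _

theorem ramp_add_ramp_neg_le (t : ℝ) : ramp (-t) + ramp t ≤ 1 := by
  unfold ramp
  grind

theorem ramp_add_ramp_neg_lt {t : ℝ} (ht : t ∈ Ioo (-1 : ℝ) 1) : ramp (-t) + ramp t < 1 := by
  have h1 := ht.1
  have h2 := ht.2
  unfold ramp
  grind

/-- The map of the plane that preserves horizontal lines, equals `g₁` on the line at height `-1`,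
the identity on the line at height `0`, and `g₂` on the line at height `1`, and interpolates
linearly in between. -/
def interpolate (g₁ g₂ : ℝ → ℝ) (z : ℝ × ℝ) : ℝ × ℝ :=
  ((1 - ramp (-z.2) - ramp z.2) * z.1 + ramp (-z.2) * g₁ z.1 + ramp z.2 * g₂ z.1, z.2)

section interpolate

variable {g₁ g₂ : ℝ → ℝ}

theorem interpolate_neg_one (x : ℝ) : interpolate g₁ g₂ (x, -1) = (g₁ x, -1) := by
  simp [interpolate, ramp]

theorem interpolate_one (x : ℝ) : interpolate g₁ g₂ (x, 1) = (g₂ x, 1) := by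
  simp [interpolate, ramp]

theorem isOpenEmbedding_interpolate (h₁ : Continuous g₁) (h₂ : Continuous g₂)
    (m₁ : StrictMono g₁) (m₂ : StrictMono g₂) :
    Topology.IsOpenEmbedding (interpolate g₁ g₂) := by
  have hr := continuous_ramp
  refine isOpenEmbedding_of_strictMono (H := fun z => (interpolate g₁ g₂ z).1)
    (by unfold interpolate; fun_prop) ?_
  intro t x y hxy
  have e1 := ramp_nonneg t
  have e2 := ramp_nonneg (-t)
  have e3 := ramp_add_ramp_neg_le t
  have f1 := m₁ hxy
  have f2 := m₂ hxy
  have k1 := mul_le_mul_of_nonneg_left f1.le e2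
  have k2 := mul_le_mul_of_nonneg_left f2.le e1
  have k3 := mul_le_mul_of_nonneg_left hxy.le (show 0 ≤ 1 - ramp (-t) - ramp t by linarith)
  simp only [interpolate]
  -- The three weights add up to `1`, so one of them is positive.
  rcases e1.lt_or_eq with h | h
  · have := mul_lt_mul_of_pos_left f2 h
    linarith
  rcases e2.lt_or_eq with h' | h'
  · have := mul_lt_mul_of_pos_left f1 h'
    linarith
  · rw [← h, ← h']
    linarith

theorem exists_interpolate_eq (h₁ : Continuous g₁) (h₂ : Continuous g₂)
    (m₁ : StrictMono g₁) (m₂ : StrictMono g₂) {z : ℝ × ℝ} (hz : z.2 ∈ Ioo (-1 : ℝ) 1) :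
    ∃ x, interpolate g₁ g₂ (x, z.2) = z := by
  obtain ⟨y, t⟩ := z
  have e1 := ramp_nonneg t
  have e2 := ramp_nonneg (-t)
  have e3 : 0 < 1 - ramp (-t) - ramp t := by linarith [ramp_add_ramp_neg_lt hz]
  set c := ramp (-t) * g₁ 0 + ramp t * g₂ 0
  have hc : Continuous fun x => (interpolate g₁ g₂ (x, t)).1 := by
    simp only [interpolate]
    fun_prop
  have htop : Filter.Tendsto (fun x => (interpolate g₁ g₂ (x, t)).1) .atTop .atTop := by
    refine Filter.tendsto_atTop_mono' _ ?_
      (Filter.tendsto_atTop_add_const_right _ c (Filter.tendsto_id.const_mul_atTop e3))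
    filter_upwards [Filter.eventually_ge_atTop 0] with x hx
    have k1 := mul_le_mul_of_nonneg_left (m₁.monotone hx) e2
    have k2 := mul_le_mul_of_nonneg_left (m₂.monotone hx) e1
    simp only [interpolate, id, c]
    linarith
  have hbot : Filter.Tendsto (fun x => (interpolate g₁ g₂ (x, t)).1) .atBot .atBot := by
    refine Filter.tendsto_atBot_mono' _ ?_
      (Filter.tendsto_atBot_add_const_right _ c (Filter.tendsto_id.const_mul_atBot e3))
    filter_upwards [Filter.eventually_le_atBot 0] with x hx
    have k1 := mul_le_mul_of_nonneg_left (m₁.monotone hx) e2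
    have k2 := mul_le_mul_of_nonneg_left (m₂.monotone hx) e1
    simp only [interpolate, id, c]
    linarith
  obtain ⟨x, hx⟩ := hc.surjective htop hbot y
  exact ⟨x, Prod.ext hx rfl⟩

end interpolate

/-! ### Maps of stripped surfaces -/

namespace StrippedSurface

theorem FHomeomorphic.trans.{u₁, v₁, u₂, v₂, u₃, v₃} {Z₁ : StrippedSurface.{u₁, v₁}}
    {Z₂ : StrippedSurface.{u₂, v₂}} {Z₃ : StrippedSurface.{u₃, v₃}}
    (h : Z₁.FHomeomorphic Z₂) (h' : Z₂.FHomeomorphic Z₃) : Z₁.FHomeomorphic Z₃ := by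
  obtain ⟨f, hf⟩ := h
  obtain ⟨g, hg⟩ := h'
  refine ⟨f.trans g, fun w hw => ?_⟩
  have := hg _ (hf w hw)
  rwa [image_image] at this

/-- The part in the strip `a` of a subset of the plane, as a subset of the disjoint union. -/
def slice (Z : StrippedSurface.{u, v}) (a : Z.A) (l : Set (ℝ × ℝ)) : Set Z.Total :=
  {z | z.1 = a ∧ (z.2 : ℝ × ℝ) ∈ l}

theorem mk_image_slice (Z : StrippedSurface.{u, v}) (a : Z.A) (l : Set (ℝ × ℝ)) :
    Quot.mk Z.Glue '' Z.slice a l = Z.image a l := by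
  ext w
  constructor
  · rintro ⟨⟨a', z⟩, ⟨rfl, h⟩, rfl⟩
    exact ⟨z, h, rfl⟩
  · rintro ⟨z, h, rfl⟩
    exact ⟨⟨a, z⟩, ⟨rfl, h⟩, rfl⟩

/-- A closed map of the disjoint unions of strips induces an `F`-homeomorphism if it identifies
points only when the source does, and carries the gluing of the source to that of the target. -/
theorem FHomeomorphic.of_isClosedMap.{u₁, v₁, u₂, v₂} {Z : StrippedSurface.{u₁, v₁}}
    {Z' : StrippedSurface.{u₂, v₂}} {F : Z.Total → Z'.Total} (hF : Continuous F)
    (hclosed : IsClosedMap F) (hsurj : Function.Surjective F)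
    (hglue : ∀ z w, Z.Glue z w → Quot.mk Z'.Glue (F z) = Quot.mk Z'.Glue (F w))
    (hinj : ∀ z w, F z = F w → Quot.mk Z.Glue z = Quot.mk Z.Glue w)
    (hglue' : ∀ z w, Z'.Glue (F z) (F w) → Quot.mk Z.Glue z = Quot.mk Z.Glue w)
    (hleaf : ∀ a, ∀ l ∈ (Z.strip a).leaves, ∃ c, ∃ l' ∈ (Z'.strip c).leaves,
      F '' Z.slice a l = Z'.slice c l') :
    Z.FHomeomorphic Z' := by
  let f : Z.Space → Z'.Space := Quot.lift (fun z => Quot.mk Z'.Glue (F z)) hglue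
  have hq : Topology.IsQuotientMap f := by
    refine .of_comp_isQuotientMap isQuotientMap_quot_mk ?_
    exact isQuotientMap_quot_mk.comp (hclosed.isQuotientMap hF hsurj)
  choose s hs using hsurj
  let g : Z'.Space → Z.Space := Quot.lift (fun w => Quot.mk Z.Glue (s w)) fun w w' h =>
    hglue' _ _ (by rwa [hs, hs])
  have hgf : Function.LeftInverse g f := by
    rintro ⟨z⟩
    exact hinj _ _ (hs _)
  let e : Z.Space ≃ₜ Z'.Space := (Equiv.ofBijective f ⟨hgf.injective, hq.surjective⟩).toHomeomorph
    fun _ => hq.isCoinducing.isOpen_preimage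
  refine ⟨e, ?_⟩
  rintro _ ⟨a, l, hl, rfl⟩
  obtain ⟨c, l', hl', h⟩ := hleaf a l hl
  refine ⟨c, l', hl', ?_⟩
  rw [← mk_image_slice, ← mk_image_slice, ← h, image_image, image_image]
  rfl

theorem total_ext (Z : StrippedSurface.{u, v}) {z w : Z.Total} (h : z.1 = w.1)
    (h' : (z.2 : ℝ × ℝ) = w.2) : z = w := by
  obtain ⟨a, z⟩ := z
  obtain ⟨b, w⟩ := w
  obtain rfl : a = b := h
  exact congrArg _ (Subtype.ext h')

end StrippedSurface

/-! ### Maximal consistent sets of edges in a graph with edges labelled by a group -/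

section GainGraph

variable {A : Type u} {B : Type v} {G : Type*} [Group G]

/-- Two vertices are linked if an edge in `D` goes from the first to the second. -/
def Link (s t : B → A) (D : Set B) (x y : A) : Prop := ∃ b ∈ D, s b = x ∧ t b = y

/-- A labelling `f` of the vertices is compatible with the labels `g` of the edges in `D` if it
changes along each of these edges by the label of the edge. -/
def IsCompatible (s t : B → A) (g : B → G) (D : Set B) (f : A → G) : Prop :=
  ∀ b ∈ D, f (t b) = f (s b) * g b

variable {s t : B → A} {g : B → G}

theorem eqvGen_link_mono {D D' : Set B} (h : D ⊆ D') {x y : A}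
    (hxy : Relation.EqvGen (Link s t D) x y) : Relation.EqvGen (Link s t D') x y :=
  hxy.mono fun _ _ ⟨b, hb, hb'⟩ => ⟨b, h hb, hb'⟩

/-- A compatible labelling is determined on a connected component by its value at one vertex, up to
left multiplication. -/
theorem IsCompatible.inv_mul_eq {D : Set B} {f f' : A → G} (hf : IsCompatible s t g D f)
    (hf' : IsCompatible s t g D f') {x y : A} (h : Relation.EqvGen (Link s t D) x y) :
    (f x)⁻¹ * f y = (f' x)⁻¹ * f' y := by
  induction h with
  | rel x y h =>
    obtain ⟨b, hb, rfl, rfl⟩ := h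
    rw [hf b hb, hf' b hb, inv_mul_cancel_left, inv_mul_cancel_left]
  | refl x => rw [inv_mul_cancel, inv_mul_cancel]
  | symm x y _ ih =>
    rw [← inv_inj]
    simpa using ih
  | trans x y z _ _ ih₁ ih₂ =>
    have := congrArg₂ (· * ·) ih₁ ih₂
    simpa [mul_assoc] using this

theorem IsCompatible.mono {D D' : Set B} {f : A → G} (h : D ⊆ D')
    (hf : IsCompatible s t g D' f) : IsCompatible s t g D f := fun b hb => hf b (h hb)

/-- Consistency passes to unions of chains: compatible labellings for the members of the chain,
normalized at a chosen vertex of each component of the union, agree where they are relevant. -/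
theorem exists_isCompatible_sUnion {c : Set (Set B)} (hc : IsChain (· ⊆ ·) c) (hne : c.Nonempty)
    (h : ∀ D ∈ c, ∃ f, IsCompatible s t g D f) : ∃ f, IsCompatible s t g (⋃₀ c) f := by
  have hdir : ∀ D ∈ c, ∀ D' ∈ c, ∃ E ∈ c, D ⊆ E ∧ D' ⊆ E := fun D hD D' hD' => by
    rcases hc.total hD hD' with h | h
    · exact ⟨D', hD', h, subset_rfl⟩
    · exact ⟨D, hD, subset_rfl, h⟩
  have hconn : ∀ x y, Relation.EqvGen (Link s t (⋃₀ c)) x y →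
      ∃ D ∈ c, Relation.EqvGen (Link s t D) x y := by
    intro x y hxy
    induction hxy with
    | rel x y h =>
      obtain ⟨b, ⟨D, hD, hb⟩, h⟩ := h
      exact ⟨D, hD, .rel _ _ ⟨b, hb, h⟩⟩
    | refl x => exact ⟨hne.some, hne.some_mem, .refl _⟩
    | symm x y _ ih =>
      obtain ⟨D, hD, h⟩ := ih
      exact ⟨D, hD, h.symm⟩
    | trans x y z _ _ ih₁ ih₂ =>
      obtain ⟨D, hD, h⟩ := ih₁
      obtain ⟨D', hD', h'⟩ := ih₂
      obtain ⟨E, hE, h₁, h₂⟩ := hdir D hD D' hD'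
      exact ⟨E, hE, (eqvGen_link_mono h₁ h).trans _ _ _ (eqvGen_link_mono h₂ h')⟩
  choose! f hf using h
  let σ := Relation.EqvGen.setoid (Link s t (⋃₀ c))
  let r : A → A := fun x => (Quotient.mk σ x).out
  have hr : ∀ x, Relation.EqvGen (Link s t (⋃₀ c)) (r x) x := fun x =>
    Quotient.exact (s := σ) (Quotient.out_eq _)
  choose E hE hEr using fun x => hconn _ _ (hr x)
  refine ⟨fun x => (f (E x) (r x))⁻¹ * f (E x) x, ?_⟩
  rintro b ⟨D, hD, hb⟩
  have hrb : r (s b) = r (t b) := congrArg Quotient.out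
    (Quotient.sound (s := σ) (.rel _ _ ⟨b, ⟨D, hD, hb⟩, rfl, rfl⟩))
  obtain ⟨D₁, hD₁, i₁, i₂⟩ := hdir _ (hE (s b)) _ (hE (t b))
  obtain ⟨D₂, hD₂, i₃, i₄⟩ := hdir _ hD₁ _ hD
  have key : ∀ x, E x ⊆ D₂ → (f (E x) (r x))⁻¹ * f (E x) x = (f D₂ (r x))⁻¹ * f D₂ x :=
    fun x hx => (hf _ (hE x)).inv_mul_eq ((hf _ hD₂).mono hx) (hEr x)
  beta_reduce
  rw [key _ (i₁.trans i₃), key _ (i₂.trans i₃), hf _ hD₂ b (i₄ hb), hrb, mul_assoc]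

/-- An edge between different components may be added to a consistent set: the labelling of one of
the two components is multiplied from the left by a suitable constant. -/
theorem exists_isCompatible_insert {D : Set B} {f : A → G} (hf : IsCompatible s t g D f) {b : B}
    (hb : ¬ Relation.EqvGen (Link s t D) (s b) (t b)) :
    ∃ f, IsCompatible s t g (insert b D) f := by
  classical
  refine ⟨fun x => if Relation.EqvGen (Link s t D) x (t b)
    then f (s b) * g b * (f (t b))⁻¹ * f x else f x, ?_⟩
  rintro b' (rfl | hb')
  · beta_reduce
    rw [if_pos (Relation.EqvGen.refl _), if_neg hb, inv_mul_cancel_right]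
  · have h : Relation.EqvGen (Link s t D) (s b') (t b') := .rel _ _ ⟨b', hb', rfl, rfl⟩
    have h' : Relation.EqvGen (Link s t D) (t b') (t b)
        ↔ Relation.EqvGen (Link s t D) (s b') (t b) :=
      ⟨fun k => h.trans _ _ _ k, fun k => h.symm.trans _ _ _ k⟩
    beta_reduce
    rw [hf b' hb']
    by_cases k : Relation.EqvGen (Link s t D) (s b') (t b)
    · rw [if_pos k, if_pos (h'.mpr k), mul_assoc _ _ (g b')]
    · rw [if_neg k, if_neg fun k' => k (h'.mp k')]

/-- A maximal consistent set of edges connects everything that can be connected. -/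
theorem exists_isCompatible_forall_eqvGen (s t : B → A) (g : B → G) (E : Set B) :
    ∃ D ⊆ E, ∃ f, IsCompatible s t g D f ∧
      ∀ b ∈ E, Relation.EqvGen (Link s t D) (s b) (t b) := by
  obtain ⟨D, -, hD⟩ := zorn_subset_nonempty {D | D ⊆ E ∧ ∃ f, IsCompatible s t g D f}
    (fun c hcS hc hne => ⟨⋃₀ c, ⟨sUnion_subset fun D hD => (hcS hD).1,
      exists_isCompatible_sUnion hc hne fun D hD => (hcS hD).2⟩, fun _ => subset_sUnion_of_mem⟩)
    ∅ ⟨empty_subset _, fun _ => 1, fun b hb => hb.elim⟩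
  obtain ⟨hDE, f, hf⟩ := hD.prop
  refine ⟨D, hDE, f, hf, fun b hb => ?_⟩
  by_contra h
  have hbD : b ∈ D := hD.le_of_ge ⟨insert_subset hb hDE, exists_isCompatible_insert hf h⟩
    (subset_insert b D) (mem_insert b D)
  exact h (.rel _ _ ⟨b, hbD, rfl, rfl⟩)

end GainGraph

/-! ### Placements of strips -/

namespace Side

/-- The height of a side as a sign. -/
def sign : Side → ℤˣ
  | lower => -1
  | upper => 1

theorem level_eq (e : Side) : e.level = ((e.sign : ℤ) : ℝ) := by
  cases e <;> simp [level, sign]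

theorem sign_injective : Function.Injective sign := by
  rintro (_ | _) (_ | _) h <;> first | rfl | exact absurd h (by decide)

/-- The side of a strip that a side is moved to by a reflection in the line of height `0`
(if `y = -1`). -/
def act (y : ℤˣ) (e : Side) : Side := if y * e.sign = 1 then upper else lower

theorem sign_act (y : ℤˣ) (e : Side) : (act y e).sign = y * e.sign := by
  rcases Int.units_eq_one_or (y * e.sign) with h | h
  · rw [act, if_pos h, h, sign]
  · rw [act, if_neg (by rw [h]; decide), h, sign]

theorem act_act (y : ℤˣ) (e : Side) : act y (act y e) = e := by
  apply sign_injective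
  rw [sign_act, sign_act, ← mul_assoc, Int.units_mul_self, one_mul]

theorem act_injective (y : ℤˣ) : Function.Injective (act y) :=
  Function.LeftInverse.injective (act_act y)

end Side

/-- A way to place a strip in a vertical chain of strips of height `2`: the height of its middle
line, whether it is turned upside down, and whether it is reflected in a vertical line.  These are
the elements of a group of symmetries of the plane, written as a map
`(x, t) ↦ (mirror * x, shift + flip * t)`. -/
@[ext]
structure Placement where
  shift : ℤ
  flip : ℤˣ
  mirror : ℤˣ

namespace Placement

instance : Mul Placement :=
  ⟨fun p q => ⟨p.shift + p.flip * q.shift, p.flip * q.flip, p.mirror * q.mirror⟩⟩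

instance : One Placement := ⟨⟨0, 1, 1⟩⟩

instance : Inv Placement := ⟨fun p => ⟨-(p.flip * p.shift), p.flip, p.mirror⟩⟩

@[simp] theorem mul_shift (p q : Placement) : (p * q).shift = p.shift + p.flip * q.shift := rfl
@[simp] theorem mul_flip (p q : Placement) : (p * q).flip = p.flip * q.flip := rfl
@[simp] theorem mul_mirror (p q : Placement) : (p * q).mirror = p.mirror * q.mirror := rfl
@[simp] theorem one_shift : (1 : Placement).shift = 0 := rfl
@[simp] theorem one_flip : (1 : Placement).flip = 1 := rfl
@[simp] theorem one_mirror : (1 : Placement).mirror = 1 := rfl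
@[simp] theorem inv_shift (p : Placement) : p⁻¹.shift = -(p.flip * p.shift) := rfl
@[simp] theorem inv_flip (p : Placement) : p⁻¹.flip = p.flip := rfl
@[simp] theorem inv_mirror (p : Placement) : p⁻¹.mirror = p.mirror := rfl

instance : Group Placement := Group.ofLeftAxioms
  (fun p q r => by ext <;> simp <;> ring)
  (fun p => by ext <;> simp)
  (fun p => by ext <;> simp)

end Placement

namespace ModelStrip.BoundaryInterval

variable {S : ModelStrip}

/-- A boundary interval is full if it is the only one on its side. -/
def IsFull (I : S.BoundaryInterval) : Prop := ∀ p ∈ S.intervals I.side, p = I.ends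

theorem lt (I : S.BoundaryInterval) : I.ends.1 < I.ends.2 := S.lt _ _ I.mem

theorem isFull_of_toSet_eq (I : S.BoundaryInterval) (h : I.toSet = S.boundary I.side) :
    I.IsFull := by
  intro p hp
  by_contra hne
  obtain ⟨x, hx⟩ := nonempty_Ioo.mpr (S.lt _ p hp)
  have hmem : (x, I.side.level) ∈ I.toSet := h ▸ ⟨rfl, p, hp, hx⟩
  exact disjoint_left.mp (S.disjoint _ hp I.mem hne) (Ioo_subset_Icc_self hx)
    (Ioo_subset_Icc_self hmem.1)

theorem eq_of_side_eq {I J : S.BoundaryInterval} (h : I.side = J.side) (h' : I.ends = J.ends) :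
    I = J := by
  obtain ⟨e, p, _⟩ := I
  obtain ⟨e', p', _⟩ := J
  obtain rfl : e = e' := h
  obtain rfl : p = p' := h'
  rfl

theorem IsFull.eq {I J : S.BoundaryInterval} (hI : I.IsFull) (h : J.side = I.side) : J = I :=
  eq_of_side_eq h (hI _ (h ▸ J.mem))

theorem toSet_subset_carrier (I : S.BoundaryInterval) : I.toSet ⊆ S.carrier := by
  rintro ⟨x, t⟩ ⟨hx, ht⟩
  exact Or.inr (mem_iUnion.mpr ⟨I.side, ht, I.ends, I.mem, hx⟩)

end ModelStrip.BoundaryInterval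

theorem ModelStrip.mem_carrier_iff (S : ModelStrip) (z : ℝ × ℝ) :
    z ∈ S.carrier ↔ z.2 ∈ Ioo (-1 : ℝ) 1 ∨ ∃ I : S.BoundaryInterval, z ∈ I.toSet := by
  constructor
  · rintro (h | h)
    · exact Or.inl h
    · obtain ⟨e, ht, p, hp, hx⟩ := mem_iUnion.mp h
      exact Or.inr ⟨⟨e, p, hp⟩, hx, ht⟩
  · rintro (h | ⟨I, h⟩)
    · exact Or.inl h
    · exact I.toSet_subset_carrier h

namespace StrippedSurface

variable (Z : StrippedSurface.{u, v})

/-- The position of the strip of `Y b` relative to the strip of `X b` when the two strips are placed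
next to each other so that the gluing `b` becomes the identity, up to scaling. -/
noncomputable def offset (b : Z.B) : Placement :=
  ⟨2 * (Z.X b).2.side.sign, -((Z.X b).2.side.sign * (Z.Y b).2.side.sign), affineSign (Z.φ b)⟩

/-- The strips joined by a gluing in `D`. -/
abbrev Joins (D : Set Z.B) : Z.A → Z.A → Prop :=
  Link (fun b => (Z.X b).1) (fun b => (Z.Y b).1) D

/-- A set of gluings along full boundary intervals, and placements of the strips that are compatible
with them. -/
structure ChainDatum where
  D : Set Z.B
  place : Z.A → Placement
  full_X : ∀ b ∈ D, (Z.X b).2.IsFull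
  full_Y : ∀ b ∈ D, (Z.Y b).2.IsFull
  compatible : ∀ b ∈ D, place (Z.Y b).1 = place (Z.X b).1 * Z.offset b

/-- The gluings can be split into chains of strips, and gluings that do not join full boundary
intervals of different chains. -/
theorem exists_chainDatum : ∃ c : Z.ChainDatum, ∀ b, (Z.X b).2.IsFull → (Z.Y b).2.IsFull →
    Relation.EqvGen (Z.Joins c.D) (Z.X b).1 (Z.Y b).1 := by
  obtain ⟨D, hD, f, hf, h⟩ := exists_isCompatible_forall_eqvGen (fun b => (Z.X b).1)
    (fun b => (Z.Y b).1) Z.offset {b | (Z.X b).2.IsFull ∧ (Z.Y b).2.IsFull}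
  exact ⟨⟨D, f, fun b hb => (hD hb).1, fun b hb => (hD hb).2, hf⟩, fun b h₁ h₂ => h b ⟨h₁, h₂⟩⟩

/-- The boundary intervals of all strips. -/
abbrev Interval := Σ a, (Z.strip a).BoundaryInterval

namespace ChainDatum

variable {Z} (c : Z.ChainDatum)

/-- The intervals `I` and `J` are glued to each other within a chain. -/
def Joined (I J : Z.Interval) : Prop :=
  ∃ b ∈ c.D, (I = Z.X b ∧ J = Z.Y b) ∨ (I = Z.Y b ∧ J = Z.X b)

variable {c}

theorem Joined.symm {I J : Z.Interval} (h : c.Joined I J) : c.Joined J I := by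
  obtain ⟨b, hb, h | h⟩ := h
  · exact ⟨b, hb, Or.inr h.symm⟩
  · exact ⟨b, hb, Or.inl h.symm⟩

theorem Joined.isFull {I J : Z.Interval} (h : c.Joined I J) : I.2.IsFull := by
  obtain ⟨b, hb, ⟨rfl, rfl⟩ | ⟨rfl, rfl⟩⟩ := h
  · exact c.full_X b hb
  · exact c.full_Y b hb

theorem Joined.eq_of_side_eq {I J K : Z.Interval} (h : c.Joined I J) (h₁ : K.1 = I.1)
    (h₂ : K.2.side = I.2.side) : K = I := by
  obtain ⟨a, I⟩ := I
  obtain ⟨a', K⟩ := K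
  obtain rfl : a' = a := h₁
  exact congrArg _ (h.isFull.eq h₂)

theorem Joined.unique {I J J' : Z.Interval} (h : c.Joined I J) (h' : c.Joined I J') :
    J = J' := by
  obtain ⟨b, hb, ⟨rfl, rfl⟩ | ⟨rfl, rfl⟩⟩ := h <;>
    obtain ⟨b', hb', ⟨h₁, rfl⟩ | ⟨h₁, rfl⟩⟩ := h'
  · rw [Z.X_injective h₁]
  · exact absurd h₁ (Z.X_ne_Y _ _)
  · exact absurd h₁.symm (Z.X_ne_Y _ _)
  · rw [Z.Y_injective h₁]

theorem Joined.flip_mul_sign {I J : Z.Interval} (h : c.Joined I J) :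
    (c.place J.1).flip * J.2.side.sign = -((c.place I.1).flip * I.2.side.sign) := by
  obtain ⟨b, hb, ⟨rfl, rfl⟩ | ⟨rfl, rfl⟩⟩ := h <;> rw [c.compatible b hb] <;>
    simp only [Placement.mul_flip, offset] <;>
    rcases Int.units_eq_one_or (Z.Y b).2.side.sign with h₁ | h₁ <;>
    simp [h₁]

theorem Joined.shift_eq {I J : Z.Interval} (h : c.Joined I J) :
    (c.place J.1).shift
      = (c.place I.1).shift + 2 * ((c.place I.1).flip * I.2.side.sign : ℤˣ) := by
  have h' := h.flip_mul_sign
  obtain ⟨b, hb, ⟨rfl, rfl⟩ | ⟨rfl, rfl⟩⟩ := h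
  · rw [c.compatible b hb]
    simp only [Placement.mul_shift, offset]
    push_cast
    ring
  · rw [← neg_eq_iff_eq_neg] at h'
    rw [← h', c.compatible b hb]
    simp only [Placement.mul_shift, offset]
    push_cast
    ring

variable (c) in
/-- The strip `a'` lies immediately above the strip `a` in a chain. -/
def Above (a a' : Z.A) : Prop :=
  ∃ I J, c.Joined I J ∧ I.1 = a ∧ J.1 = a' ∧ (c.place a).flip * I.2.side.sign = 1

theorem Above.shift_eq {a a' : Z.A} (h : c.Above a a') :
    (c.place a').shift = (c.place a).shift + 2 := by
  obtain ⟨I, J, h, rfl, rfl, h'⟩ := h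
  rw [h.shift_eq, h']
  simp

theorem Joined.above_or {I J : Z.Interval} (h : c.Joined I J) :
    c.Above I.1 J.1 ∨ c.Above J.1 I.1 := by
  rcases Int.units_eq_one_or ((c.place I.1).flip * I.2.side.sign) with h' | h'
  · exact Or.inl ⟨I, J, h, rfl, rfl, h'⟩
  · refine Or.inr ⟨J, I, h.symm, rfl, rfl, ?_⟩
    rw [h.flip_mul_sign, h', neg_neg]

theorem above_rightUnique : Relator.RightUnique c.Above := by
  rintro a _ _ ⟨I, J, h, rfl, rfl, hs⟩ ⟨I', J', h', ha, rfl, hs'⟩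
  have : I' = I := h.eq_of_side_eq ha (Side.sign_injective (mul_left_cancel (hs'.trans hs.symm)))
  subst this
  rw [h.unique h']

theorem above_leftUnique : Relator.RightUnique (Function.swap c.Above) := by
  rintro a _ _ ⟨I, J, h, rfl, rfl, hs⟩ ⟨I', J', h', rfl, ha, hs'⟩
  have hJ := h.flip_mul_sign
  have hJ' := h'.flip_mul_sign
  rw [hs] at hJ
  rw [hs', congrArg c.place ha] at hJ'
  have : J' = J := h.symm.eq_of_side_eq ha
    (Side.sign_injective (mul_left_cancel (hJ'.trans hJ.symm)))
  subst this
  rw [h.symm.unique h'.symm]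

variable (c) in
/-- The equivalence relation whose classes are the chains of strips. -/
def chainSetoid : Setoid Z.A := Relation.EqvGen.setoid (Z.Joins c.D)

theorem Joined.equiv {I J : Z.Interval} (h : c.Joined I J) : c.chainSetoid I.1 J.1 := by
  obtain ⟨b, hb, ⟨rfl, rfl⟩ | ⟨rfl, rfl⟩⟩ := h
  · exact .rel _ _ ⟨b, hb, rfl, rfl⟩
  · exact .symm _ _ (.rel _ _ ⟨b, hb, rfl, rfl⟩)

/-- As every strip has at most one strip immediately above it and at most one immediately below it,
any two strips of a chain are comparable. -/
theorem reflTransGen_above_or {a a' : Z.A} (h : c.chainSetoid a a') :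
    Relation.ReflTransGen c.Above a a' ∨ Relation.ReflTransGen c.Above a' a := by
  change Relation.EqvGen _ a a' at h
  induction h with
  | rel x y h =>
    obtain ⟨b, hb, rfl, rfl⟩ := h
    have h : c.Joined (Z.X b) (Z.Y b) := ⟨b, hb, Or.inl ⟨rfl, rfl⟩⟩
    exact h.above_or.imp .single .single
  | refl x => exact Or.inl .refl
  | symm x y _ ih => exact ih.symm
  | trans x y z _ _ ih₁ ih₂ =>
    rcases ih₁ with h₁ | h₁ <;> rcases ih₂ with h₂ | h₂
    · exact Or.inl (h₁.trans h₂)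
    · have := Relation.ReflTransGen.total_of_right_unique above_leftUnique
        (Relation.reflTransGen_swap.mpr h₁) (Relation.reflTransGen_swap.mpr h₂)
      exact (this.imp Relation.reflTransGen_swap.mp Relation.reflTransGen_swap.mp).symm
    · exact Relation.ReflTransGen.total_of_right_unique above_rightUnique h₁ h₂
    · exact Or.inr (h₂.trans h₁)

theorem shift_le_of_reflTransGen {a a' : Z.A} (h : Relation.ReflTransGen c.Above a a') :
    (c.place a).shift ≤ (c.place a').shift := by
  induction h with
  | refl => exact le_rfl
  | tail _ h ih =>
    have := h.shift_eq
    omega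

variable (c) in
/-- The properties of a strip `a` and a strip `a'` higher up in the same chain that are used to
compare their bands: neither ends the chain on the side of the other, their heights differ by at
least `2`, and if they differ by exactly `2` then `a'` lies immediately above `a`. -/
def Below (a a' : Z.A) : Prop :=
  (∃ a₁, c.Above a a₁) ∧ (∃ a₂, c.Above a₂ a') ∧
    (c.place a).shift + 2 ≤ (c.place a').shift ∧
    ((c.place a').shift = (c.place a).shift + 2 → c.Above a a')

theorem below_of_reflTransGen {a a' : Z.A} (h : Relation.ReflTransGen c.Above a a') :
    a = a' ∨ c.Below a a' := by
  rcases h.cases_head with rfl | ⟨a₁, h₁, h₁'⟩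
  · exact Or.inl rfl
  rcases h.cases_tail with rfl | ⟨a₂, h₂', h₂⟩
  · exact Or.inl rfl
  refine Or.inr ⟨⟨a₁, h₁⟩, ⟨a₂, h₂⟩, ?_, fun hs => ?_⟩
  · have := shift_le_of_reflTransGen h₁'
    have := h₁.shift_eq
    omega
  · rcases h₁'.cases_head with rfl | ⟨a₃, h₃, h₃'⟩
    · exact h₁
    · have := shift_le_of_reflTransGen h₃'
      have := h₁.shift_eq
      have := h₃.shift_eq
      omega

theorem below_trichotomy {a a' : Z.A} (h : c.chainSetoid a a') :
    a = a' ∨ c.Below a a' ∨ c.Below a' a := by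
  rcases reflTransGen_above_or h with h | h
  · exact (below_of_reflTransGen h).imp_right Or.inl
  · rcases below_of_reflTransGen h with h | h
    · exact Or.inl h.symm
    · exact Or.inr (Or.inr h)

end ChainDatum

end StrippedSurface

/-! ### Reflections of intervals -/

theorem unit_mul_self_mul (s : ℤˣ) (x : ℝ) : ((s : ℤ) : ℝ) * (((s : ℤ) : ℝ) * x) = x := by
  rcases Int.units_eq_one_or s with rfl | rfl <;> simp

/-- The end points of the image of an interval under the multiplication by a sign. -/
def mirrorEnds (s : ℤˣ) (p : ℝ × ℝ) : ℝ × ℝ := if s = 1 then p else (-p.2, -p.1)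

theorem mirrorEnds_neg_one (p : ℝ × ℝ) : mirrorEnds (-1) p = (-p.2, -p.1) :=
  if_neg (by decide)

theorem mirrorEnds_injective (s : ℤˣ) : Function.Injective (mirrorEnds s) := by
  rcases Int.units_eq_one_or s with rfl | rfl
  · exact fun p q h => h
  · intro p q h
    rw [mirrorEnds_neg_one, mirrorEnds_neg_one, Prod.mk.injEq, neg_inj, neg_inj] at h
    exact Prod.ext h.2 h.1

theorem mem_Icc_mirrorEnds {s : ℤˣ} {p : ℝ × ℝ} {x : ℝ} :
    x ∈ Icc (mirrorEnds s p).1 (mirrorEnds s p).2 ↔ ((s : ℤ) : ℝ) * x ∈ Icc p.1 p.2 := by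
  rcases Int.units_eq_one_or s with rfl | rfl
  · simp [mirrorEnds]
  · simp only [mirrorEnds_neg_one, mem_Icc]
    push_cast
    constructor <;> rintro ⟨h₁, h₂⟩ <;> constructor <;> linarith

theorem mem_Ioo_mirrorEnds {s : ℤˣ} {p : ℝ × ℝ} {x : ℝ} :
    x ∈ Ioo (mirrorEnds s p).1 (mirrorEnds s p).2 ↔ ((s : ℤ) : ℝ) * x ∈ Ioo p.1 p.2 := by
  rcases Int.units_eq_one_or s with rfl | rfl
  · simp [mirrorEnds]
  · simp only [mirrorEnds_neg_one, mem_Ioo]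
    push_cast
    constructor <;> rintro ⟨h₁, h₂⟩ <;> constructor <;> linarith

theorem mirrorEnds_lt (s : ℤˣ) {p : ℝ × ℝ} (hp : p.1 < p.2) :
    (mirrorEnds s p).1 < (mirrorEnds s p).2 := by
  rcases Int.units_eq_one_or s with rfl | rfl
  · exact hp
  · rw [mirrorEnds_neg_one]
    exact neg_lt_neg hp

/-- Multiplication by a sign as an affine automorphism of the line. -/
noncomputable def signEquiv (s : ℤˣ) : ℝ ≃ᵃ[ℝ] ℝ :=
  (LinearEquiv.smulOfNeZero ℝ ℝ ((s : ℤ) : ℝ) (Int.cast_ne_zero.mpr s.ne_zero)).toAffineEquiv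

theorem signEquiv_apply (s : ℤˣ) (x : ℝ) : signEquiv s x = ((s : ℤ) : ℝ) * x := rfl

namespace StrippedSurface.ChainDatum

variable {Z : StrippedSurface.{u, v}} (c : Z.ChainDatum)

/-! ### The vertical coordinate in a chain -/

/-- The side `e` of the strip `a` is glued to another strip of the chain. -/
def Glued (a : Z.A) (e : Side) : Prop := ∃ I J, c.Joined I J ∧ I.1 = a ∧ I.2.side = e

/-- The side of the strip `a` that faces in the direction `d` in the chain. -/
def facing (a : Z.A) (d : Side) : Side := Side.act (c.place a).flip d

variable {c}

theorem flip_mul_sign_facing (a : Z.A) (d : Side) :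
    (c.place a).flip * (c.facing a d).sign = d.sign := by
  rw [facing, Side.sign_act, ← mul_assoc, Int.units_mul_self, one_mul]

theorem facing_facing (a : Z.A) (d : Side) : c.facing a (c.facing a d) = d := Side.act_act _ _

theorem exists_eq_facing (a : Z.A) (e : Side) : ∃ d, e = c.facing a d :=
  ⟨_, (facing_facing a e).symm⟩

theorem Joined.glued {I J : Z.Interval} (h : c.Joined I J) : c.Glued I.1 I.2.side :=
  ⟨I, J, h, rfl, rfl⟩

theorem exists_joined_of_glued {I : Z.Interval} (h : c.Glued I.1 I.2.side) :
    ∃ J, c.Joined I J := by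
  obtain ⟨K, J, h, h₁, h₂⟩ := h
  rw [h.eq_of_side_eq h₁.symm h₂.symm]
  exact ⟨J, h⟩

theorem Above.glued_left {a a' : Z.A} (h : c.Above a a') : c.Glued a (c.facing a .upper) := by
  obtain ⟨I, J, h, rfl, rfl, hs⟩ := h
  refine ⟨I, J, h, rfl, Side.sign_injective (mul_left_cancel (a := (c.place I.1).flip) ?_)⟩
  rw [hs, flip_mul_sign_facing, Side.sign]

theorem Above.glued_right {a a' : Z.A} (h : c.Above a a') : c.Glued a' (c.facing a' .lower) := by
  obtain ⟨I, J, h, rfl, rfl, hs⟩ := h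
  refine ⟨J, I, h.symm, rfl, Side.sign_injective (mul_left_cancel (a := (c.place J.1).flip) ?_)⟩
  rw [h.flip_mul_sign, hs, flip_mul_sign_facing, Side.sign]

theorem exists_above {a : Z.A} (h : c.Glued a (c.facing a .upper)) : ∃ a', c.Above a a' := by
  obtain ⟨I, J, h, rfl, hs⟩ := h
  refine ⟨J.1, I, J, h, rfl, rfl, ?_⟩
  rw [hs, flip_mul_sign_facing, Side.sign]

theorem exists_below {a : Z.A} (h : c.Glued a (c.facing a .lower)) : ∃ a', c.Above a' a := by
  obtain ⟨I, J, h, rfl, hs⟩ := h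
  refine ⟨J.1, J, I, h.symm, rfl, rfl, ?_⟩
  rw [h.flip_mul_sign, hs, flip_mul_sign_facing, Side.sign, neg_neg]

/-- A chain has at most one highest and at most one lowest strip. -/
theorem eq_of_not_glued {a a' : Z.A} (h : c.chainSetoid a a') {d : Side}
    (ha : ¬ c.Glued a (c.facing a d)) (ha' : ¬ c.Glued a' (c.facing a' d)) : a = a' := by
  rcases below_trichotomy h with h | ⟨⟨_, h₁⟩, ⟨_, h₂⟩, -⟩ | ⟨⟨_, h₁⟩, ⟨_, h₂⟩, -⟩
  · exact h
  · cases d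
    · exact absurd h₂.glued_right ha'
    · exact absurd h₁.glued_left ha
  · cases d
    · exact absurd h₂.glued_right ha
    · exact absurd h₁.glued_left ha'

variable (c) in
open Classical in
/-- The height of the side `e` of the strip `a` in the model strip that represents the chain.  The
chain is placed in an infinite pile of strips, which is squashed to `ℝ × (-1, 1)`; a side at the end
of the chain is moved on to the boundary. -/
noncomputable def bound (a : Z.A) (e : Side) : ℝ :=
  if c.Glued a e then squash (((c.place a).shift + ((c.place a).flip * e.sign : ℤˣ) : ℤ) : ℝ)
  else (((c.place a).flip * e.sign : ℤˣ) : ℤ)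

theorem bound_of_glued {a : Z.A} {d : Side} (h : c.Glued a (c.facing a d)) :
    c.bound a (c.facing a d) = squash (((c.place a).shift + d.sign : ℤ) : ℝ) := by
  rw [bound, if_pos h, flip_mul_sign_facing]

theorem bound_of_not_glued {a : Z.A} {d : Side} (h : ¬ c.Glued a (c.facing a d)) :
    c.bound a (c.facing a d) = d.level := by
  rw [bound, if_neg h, flip_mul_sign_facing, Side.level_eq]

theorem bound_mem_Ioo {a : Z.A} {e : Side} (h : c.Glued a e) : c.bound a e ∈ Ioo (-1 : ℝ) 1 := by
  rw [bound, if_pos h]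
  exact squash_mem _

theorem Joined.bound_eq {I J : Z.Interval} (h : c.Joined I J) :
    c.bound I.1 I.2.side = c.bound J.1 J.2.side := by
  rw [bound, bound, if_pos h.glued, if_pos h.symm.glued, h.flip_mul_sign, h.shift_eq]
  congr 2
  push_cast
  ring

variable (c) in
/-- The lower end of the band occupied by the strip `a`. -/
noncomputable def lo (a : Z.A) : ℝ := c.bound a (c.facing a .lower)

variable (c) in
/-- The upper end of the band occupied by the strip `a`. -/
noncomputable def hi (a : Z.A) : ℝ := c.bound a (c.facing a .upper)

theorem lo_of_glued {a : Z.A} (h : c.Glued a (c.facing a .lower)) :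
    c.lo a = squash ((c.place a).shift - 1) := by
  rw [lo, bound_of_glued h]
  push_cast [Side.sign]
  ring_nf

theorem hi_of_glued {a : Z.A} (h : c.Glued a (c.facing a .upper)) :
    c.hi a = squash ((c.place a).shift + 1) := by
  rw [hi, bound_of_glued h]
  push_cast [Side.sign]
  ring_nf

theorem lo_of_not_glued {a : Z.A} (h : ¬ c.Glued a (c.facing a .lower)) : c.lo a = -1 :=
  bound_of_not_glued h

theorem hi_of_not_glued {a : Z.A} (h : ¬ c.Glued a (c.facing a .upper)) : c.hi a = 1 :=
  bound_of_not_glued h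

theorem lo_le (a : Z.A) : c.lo a ≤ squash ((c.place a).shift - 1) := by
  by_cases h : c.Glued a (c.facing a .lower)
  · exact (lo_of_glued h).le
  · rw [lo_of_not_glued h]
    exact (squash_mem _).1.le

theorem le_hi (a : Z.A) : squash ((c.place a).shift + 1) ≤ c.hi a := by
  by_cases h : c.Glued a (c.facing a .upper)
  · exact (hi_of_glued h).ge
  · rw [hi_of_not_glued h]
    exact (squash_mem _).2.le

theorem lo_lt_hi (a : Z.A) : c.lo a < c.hi a :=
  (lo_le a).trans_lt ((squash_strictMono (by linarith)).trans_le (le_hi a))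

theorem neg_one_le_lo (a : Z.A) : -1 ≤ c.lo a := by
  by_cases h : c.Glued a (c.facing a .lower)
  · exact (bound_mem_Ioo h).1.le
  · exact (lo_of_not_glued h).ge

theorem hi_le_one (a : Z.A) : c.hi a ≤ 1 := by
  by_cases h : c.Glued a (c.facing a .upper)
  · exact (bound_mem_Ioo h).2.le
  · exact (hi_of_not_glued h).le

theorem bound_mem_Icc (a : Z.A) (e : Side) : c.bound a e ∈ Icc (c.lo a) (c.hi a) := by
  obtain ⟨d, rfl⟩ := exists_eq_facing (c := c) a e
  cases d
  · exact ⟨le_rfl, (lo_lt_hi a).le⟩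
  · exact ⟨(lo_lt_hi a).le, le_rfl⟩

theorem Below.hi_le {a a' : Z.A} (h : c.Below a a') :
    c.hi a ≤ squash ((c.place a').shift - 1) := by
  obtain ⟨⟨_, h₁⟩, ⟨_, h₂⟩, h₃, -⟩ := h
  rw [hi_of_glued h₁.glued_left]
  have h₃' : ((c.place a).shift : ℝ) + 2 ≤ (c.place a').shift := by exact_mod_cast h₃
  exact squash_strictMono.monotone (by linarith)

theorem Below.hi_le_lo {a a' : Z.A} (h : c.Below a a') : c.hi a ≤ c.lo a' := by
  obtain ⟨_, h₂⟩ := h.2.1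
  rw [lo_of_glued h₂.glued_right]
  exact h.hi_le

/-- Different strips of a chain whose bands meet are neighbours. -/
theorem Below.above_of_le {a a' : Z.A} (h : c.Below a a') (hle : c.lo a' ≤ c.hi a) :
    c.Above a a' := by
  obtain ⟨⟨_, h₁⟩, ⟨_, h₂⟩, h₃, h₄⟩ := h
  rw [hi_of_glued h₁.glued_left, lo_of_glued h₂.glued_right, squash_strictMono.le_iff_le] at hle
  refine h₄ (le_antisymm ?_ h₃)
  have : ((c.place a').shift : ℝ) ≤ (c.place a).shift + 2 := by linarith
  exact_mod_cast this

/-- The bands of the strips of a chain cover the interval `(-1, 1)`: going from strip to strip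
towards a given height, it is reached after finitely many steps. -/
theorem exists_mem_band (a : Z.A) {h : ℝ} (hh : h ∈ Ioo (-1 : ℝ) 1) :
    ∃ a', c.chainSetoid a' a ∧ h ∈ Icc (c.lo a') (c.hi a') := by
  obtain ⟨r, rfl⟩ := exists_squash_eq hh
  have hequiv : ∀ {a a' : Z.A}, c.Above a a' → c.chainSetoid a a' := by
    rintro _ _ ⟨I, J, h, rfl, rfl, -⟩
    exact h.equiv
  have up : ∀ (n : ℕ) (a : Z.A), c.lo a ≤ squash r → r < (c.place a).shift + n →
      ∃ a', c.chainSetoid a' a ∧ squash r ∈ Icc (c.lo a') (c.hi a') := by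
    intro n
    induction n with
    | zero =>
      intro a h₁ h₂
      rw [Nat.cast_zero] at h₂
      exact ⟨a, c.chainSetoid.refl' _, h₁, (squash_strictMono (by linarith)).le.trans (le_hi a)⟩
    | succ n ih =>
      intro a h₁ h₂
      by_cases h₃ : squash r ≤ c.hi a
      · exact ⟨a, c.chainSetoid.refl' _, h₁, h₃⟩
      have hg : c.Glued a (c.facing a .upper) := by
        by_contra hg
        rw [hi_of_not_glued hg] at h₃
        exact h₃ hh.2.le
      obtain ⟨a₁, ha₁⟩ := exists_above hg
      have hs : ((c.place a₁).shift : ℝ) = (c.place a).shift + 2 := by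
        exact_mod_cast ha₁.shift_eq
      rw [hi_of_glued hg, not_le] at h₃
      push_cast at h₂
      obtain ⟨a', h', h''⟩ := ih a₁
        ((lo_le a₁).trans (by rw [hs]; convert h₃.le using 2; ring)) (by rw [hs]; linarith)
      exact ⟨a', c.chainSetoid.trans' h' (c.chainSetoid.symm' (hequiv ha₁)), h''⟩
  have down : ∀ (n : ℕ) (a : Z.A), squash r ≤ c.hi a → (c.place a).shift - n < r →
      ∃ a', c.chainSetoid a' a ∧ squash r ∈ Icc (c.lo a') (c.hi a') := by
    intro n
    induction n with
    | zero =>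
      intro a h₁ h₂
      rw [Nat.cast_zero] at h₂
      exact ⟨a, c.chainSetoid.refl' _, (lo_le a).trans (squash_strictMono (by linarith)).le, h₁⟩
    | succ n ih =>
      intro a h₁ h₂
      by_cases h₃ : c.lo a ≤ squash r
      · exact ⟨a, c.chainSetoid.refl' _, h₃, h₁⟩
      have hg : c.Glued a (c.facing a .lower) := by
        by_contra hg
        rw [lo_of_not_glued hg] at h₃
        exact h₃ hh.1.le
      obtain ⟨a₁, ha₁⟩ := exists_below hg
      have hs : ((c.place a).shift : ℝ) = (c.place a₁).shift + 2 := by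
        exact_mod_cast ha₁.shift_eq
      rw [lo_of_glued hg, not_le] at h₃
      push_cast at h₂
      obtain ⟨a', h', h''⟩ := ih a₁
        (le_trans (by rw [hs] at h₃; convert h₃.le using 2; ring) (le_hi a₁))
        (by rw [hs] at h₂; linarith)
      exact ⟨a', c.chainSetoid.trans' h' (hequiv ha₁), h''⟩
  rcases le_total (c.lo a) (squash r) with h | h
  · obtain ⟨n, hn⟩ := exists_nat_gt (r - (c.place a).shift)
    exact up n a h (by linarith)
  · obtain ⟨n, hn⟩ := exists_nat_gt ((c.place a).shift - r)
    exact down n a (h.trans (lo_lt_hi a).le) (by linarith)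

variable (c) in
/-- The map from the straightened strip `a` to the model strip that represents its chain. -/
noncomputable def toChain (a : Z.A) (p : ℝ × ℝ) : ℝ × ℝ :=
  (((c.place a).mirror : ℤ) * p.1,
    c.lo a + (c.hi a - c.lo a) * ((1 + ((c.place a).flip : ℤ) * p.2) / 2))

variable (c) in
/-- The inverse of `toChain`. -/
noncomputable def ofChain (a : Z.A) (w : ℝ × ℝ) : ℝ × ℝ :=
  (((c.place a).mirror : ℤ) * w.1,
    ((c.place a).flip : ℤ) * (2 * ((w.2 - c.lo a) / (c.hi a - c.lo a)) - 1))

theorem continuous_toChain (a : Z.A) : Continuous (c.toChain a) := by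
  unfold toChain
  fun_prop

theorem continuous_ofChain (a : Z.A) : Continuous (c.ofChain a) := by
  unfold ofChain
  fun_prop

theorem toChain_ofChain (a : Z.A) (w : ℝ × ℝ) : c.toChain a (c.ofChain a w) = w := by
  have h : c.hi a - c.lo a ≠ 0 := (sub_pos.mpr (lo_lt_hi a)).ne'
  ext
  · exact unit_mul_self_mul _ _
  · simp only [toChain, ofChain, unit_mul_self_mul]
    field_simp
    ring

theorem ofChain_toChain (a : Z.A) (p : ℝ × ℝ) : c.ofChain a (c.toChain a p) = p := by
  have h : c.hi a - c.lo a ≠ 0 := (sub_pos.mpr (lo_lt_hi a)).ne'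
  ext
  · exact unit_mul_self_mul _ _
  · simp only [toChain, ofChain, add_sub_cancel_left, mul_div_cancel_left₀ _ h]
    rw [mul_div_cancel₀ _ two_ne_zero, add_sub_cancel_left, unit_mul_self_mul]

theorem toChain_injective (a : Z.A) : Function.Injective (c.toChain a) :=
  Function.LeftInverse.injective (ofChain_toChain a)

theorem toChain_snd_level (a : Z.A) (x : ℝ) (e : Side) :
    (c.toChain a (x, e.level)).2 = c.bound a e := by
  obtain ⟨d, rfl⟩ := exists_eq_facing (c := c) a e
  simp only [toChain, Side.level_eq]
  rw [← Int.cast_mul, ← Units.val_mul, flip_mul_sign_facing]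
  cases d
  · simp only [Side.sign, lo]
    push_cast
    ring
  · simp only [Side.sign, hi]
    push_cast
    ring

theorem toChain_snd_mem_Ioo {a : Z.A} {p : ℝ × ℝ} (hp : p.2 ∈ Ioo (-1 : ℝ) 1) :
    (c.toChain a p).2 ∈ Ioo (c.lo a) (c.hi a) := by
  have h := sub_pos.mpr (lo_lt_hi (c := c) a)
  obtain ⟨h₁, h₂⟩ := hp
  simp only [toChain]
  rcases Int.units_eq_one_or (c.place a).flip with hf | hf <;> rw [hf] <;> push_cast <;>
    constructor <;> nlinarith

/-- A height in the band of the strip `a` comes from the interior of this strip or is that of one of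
its sides. -/
theorem ofChain_snd_mem {a : Z.A} {w : ℝ × ℝ} (hw : w.2 ∈ Icc (c.lo a) (c.hi a)) :
    (c.ofChain a w).2 ∈ Ioo (-1 : ℝ) 1 ∨
      ∃ e : Side, (c.ofChain a w).2 = e.level ∧ w.2 = c.bound a e := by
  have h := sub_pos.mpr (lo_lt_hi (c := c) a)
  have key : ∀ d : Side, w.2 = c.bound a (c.facing a d) →
      (c.ofChain a w).2 = (c.facing a d).level := by
    intro d hd
    have : w = c.toChain a (((c.place a).mirror : ℤ) * w.1, (c.facing a d).level) := by
      ext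
      · exact (unit_mul_self_mul _ _).symm
      · rw [toChain_snd_level, hd]
    rw [this, ofChain_toChain]
  rcases hw.1.eq_or_lt with h₁ | h₁
  · exact Or.inr ⟨_, key .lower h₁.symm, h₁.symm⟩
  rcases hw.2.eq_or_lt with h₂ | h₂
  · exact Or.inr ⟨_, key .upper h₂, h₂⟩
  left
  have h₃ : 0 < (w.2 - c.lo a) / (c.hi a - c.lo a) := div_pos (by linarith) h
  have h₄ : (w.2 - c.lo a) / (c.hi a - c.lo a) < 1 := by
    rw [div_lt_one h]
    linarith
  simp only [ofChain]
  rcases Int.units_eq_one_or (c.place a).flip with hf | hf <;> rw [hf] <;> push_cast <;>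
    constructor <;> linarith

/-! ### Straightening the glued sides of a strip -/

variable (c) in
open Classical in
/-- The parametrization of the side `e` of the strip `a` used for straightening: a bijection from
the line onto the boundary interval if the side is glued within the chain, and the identity
otherwise. -/
noncomputable def profile (a : Z.A) (e : Side) : ℝ → ℝ :=
  if h : c.Glued a e then stretch h.choose.2.ends else id

theorem Joined.profile_eq {I J : Z.Interval} (h : c.Joined I J) :
    c.profile I.1 I.2.side = stretch I.2.ends := by
  rw [profile, dif_pos h.glued]
  obtain ⟨_, _, h₁, h₂⟩ := h.glued.choose_spec
  rw [h.eq_of_side_eq h₁ h₂]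

theorem profile_of_not_glued {a : Z.A} {e : Side} (h : ¬ c.Glued a e) : c.profile a e = id :=
  dif_neg h

theorem continuous_profile (a : Z.A) (e : Side) : Continuous (c.profile a e) := by
  by_cases h : c.Glued a e
  · obtain ⟨I, J, h, rfl, rfl⟩ := h
    rw [h.profile_eq]
    exact continuous_stretch _
  · rw [profile_of_not_glued h]
    exact continuous_id

theorem profile_strictMono (a : Z.A) (e : Side) : StrictMono (c.profile a e) := by
  by_cases h : c.Glued a e
  · obtain ⟨I, J, h, rfl, rfl⟩ := h
    rw [h.profile_eq]
    exact stretch_strictMono I.2.lt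
  · rw [profile_of_not_glued h]
    exact strictMono_id

variable (c) in
/-- The map from the straightened strip, in which the sides glued within the chain have become whole
lines, to the strip `a`. -/
noncomputable def spread (a : Z.A) : ℝ × ℝ → ℝ × ℝ :=
  interpolate (c.profile a .lower) (c.profile a .upper)

theorem spread_level (a : Z.A) (x : ℝ) (e : Side) :
    c.spread a (x, e.level) = (c.profile a e x, e.level) := by
  cases e
  · exact interpolate_neg_one x
  · exact interpolate_one x

theorem Joined.spread_eq {I J : Z.Interval} (h : c.Joined I J) (x : ℝ) :
    c.spread I.1 (x, I.2.side.level) = (stretch I.2.ends x, I.2.side.level) := by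
  rw [spread_level, h.profile_eq]

theorem spread_eq_self {a : Z.A} {I : (Z.strip a).BoundaryInterval} (h : ¬ c.Glued a I.side)
    {p : ℝ × ℝ} (hp : p ∈ I.toSet) : c.spread a p = p := by
  obtain ⟨x, t⟩ := p
  obtain ⟨-, rfl : t = _⟩ := hp
  rw [spread_level, profile_of_not_glued h, id]

theorem isOpenEmbedding_spread (a : Z.A) : Topology.IsOpenEmbedding (c.spread a) :=
  isOpenEmbedding_interpolate (continuous_profile _ _) (continuous_profile _ _)
    (profile_strictMono _ _) (profile_strictMono _ _)

variable (c) in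
/-- The straightened strip. -/
def straight (a : Z.A) : Set (ℝ × ℝ) := c.spread a ⁻¹' (Z.strip a).carrier

theorem mem_straight_of_mem_Ioo {a : Z.A} {p : ℝ × ℝ} (hp : p.2 ∈ Ioo (-1 : ℝ) 1) :
    p ∈ c.straight a := Or.inl hp

theorem mem_straight_of_glued {a : Z.A} {e : Side} (h : c.Glued a e) {p : ℝ × ℝ}
    (hp : p.2 = e.level) : p ∈ c.straight a := by
  obtain ⟨I, J, h, rfl, rfl⟩ := h
  obtain ⟨x, t⟩ := p
  obtain rfl : t = _ := hp
  refine I.2.toSet_subset_carrier ?_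
  rw [h.spread_eq]
  exact ⟨stretch_mem I.2.lt x, rfl⟩

theorem mem_straight_of_not_glued {a : Z.A} {I : (Z.strip a).BoundaryInterval}
    (h : ¬ c.Glued a I.side) {p : ℝ × ℝ} (hp : p ∈ I.toSet) : p ∈ c.straight a := by
  change c.spread a p ∈ (Z.strip a).carrier
  rw [spread_eq_self h hp]
  exact I.toSet_subset_carrier hp

theorem straight_cases {a : Z.A} {p : ℝ × ℝ} (hp : p ∈ c.straight a) :
    p.2 ∈ Ioo (-1 : ℝ) 1 ∨ (∃ e : Side, p.2 = e.level ∧ c.Glued a e) ∨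
      ∃ I : (Z.strip a).BoundaryInterval, ¬ c.Glued a I.side ∧ p ∈ I.toSet := by
  rcases ((Z.strip a).mem_carrier_iff _).mp hp with h | ⟨I, h⟩
  · exact Or.inl h
  right
  have hp2 : p.2 = I.side.level := h.2
  by_cases hg : c.Glued a I.side
  · exact Or.inl ⟨_, hp2, hg⟩
  · refine Or.inr ⟨I, hg, ?_⟩
    obtain ⟨x, t⟩ := p
    obtain rfl : t = _ := hp2
    rwa [spread_level, profile_of_not_glued hg] at h

theorem exists_spread_eq {a : Z.A} {z : ℝ × ℝ} (hz : z ∈ (Z.strip a).carrier) :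
    ∃ p, c.spread a p = z := by
  rcases ((Z.strip a).mem_carrier_iff z).mp hz with h | ⟨I, h⟩
  · obtain ⟨x, hx⟩ := exists_interpolate_eq (continuous_profile (c := c) a .lower)
      (continuous_profile a .upper) (profile_strictMono _ _) (profile_strictMono _ _) h
    exact ⟨_, hx⟩
  by_cases hg : c.Glued a I.side
  · obtain ⟨J, hJ⟩ := exists_joined_of_glued (I := ⟨a, I⟩) hg
    obtain ⟨x, hx⟩ := exists_stretch_eq h.1
    exact ⟨_, (hJ.spread_eq x).trans (Prod.ext hx h.2.symm)⟩
  · exact ⟨z, spread_eq_self hg h⟩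

/-! ### The surface obtained by merging the chains into single strips -/

variable (c) in
/-- The model strip that represents a chain: its boundary intervals are those of the lowest and of
the highest strip of the chain on the outer sides, as far as there are such strips. -/
def chainStrip (q : Quotient c.chainSetoid) : ModelStrip where
  intervals d := {p | ∃ I : Z.Interval, Quotient.mk c.chainSetoid I.1 = q ∧
    ¬ c.Glued I.1 I.2.side ∧ c.facing I.1 I.2.side = d ∧
    p = mirrorEnds (c.place I.1).mirror I.2.ends}
  lt := by
    rintro d _ ⟨I, -, -, -, rfl⟩
    exact mirrorEnds_lt _ I.2.lt
  disjoint := by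
    rintro d _ ⟨I, rfl, hI, hd, rfl⟩ _ ⟨J, hq, hJ, hd', rfl⟩ hne
    obtain ⟨a, I⟩ := I
    obtain ⟨a', J⟩ := J
    dsimp only at hI hd hq hJ hd' hne ⊢
    have h₁ : I.side = c.facing a d := by rw [← hd, facing_facing]
    have h₂ : J.side = c.facing a' d := by rw [← hd', facing_facing]
    rw [h₁] at hI
    rw [h₂] at hJ
    obtain rfl : a' = a := eq_of_not_glued (Quotient.exact hq) hJ hI
    rw [Function.onFun, disjoint_left]
    intro x hx hx'
    rw [mem_Icc_mirrorEnds] at hx hx'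
    refine disjoint_left.mp ((Z.strip a').disjoint _ I.mem ((h₂.trans h₁.symm) ▸ J.mem) ?_) hx hx'
    rintro h
    exact hne (congrArg _ h)

variable (c) in
/-- An interval that is not glued within a chain, as a boundary interval of the strip that
represents its chain. -/
def outer (I : Z.Interval) (hI : ¬ c.Glued I.1 I.2.side) :
    Σ q, (c.chainStrip q).BoundaryInterval :=
  ⟨Quotient.mk c.chainSetoid I.1, c.facing I.1 I.2.side,
    mirrorEnds (c.place I.1).mirror I.2.ends, I, rfl, hI, rfl, rfl⟩

theorem outer_injective {I J : Z.Interval} {hI : ¬ c.Glued I.1 I.2.side}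
    {hJ : ¬ c.Glued J.1 J.2.side} (h : c.outer I hI = c.outer J hJ) : I = J := by
  have h₁ := congrArg (fun K => K.1) h
  have h₂ : c.facing I.1 I.2.side = c.facing J.1 J.2.side :=
    congrArg (fun K : Σ q, (c.chainStrip q).BoundaryInterval => K.2.side) h
  have h₃ : mirrorEnds (c.place I.1).mirror I.2.ends = mirrorEnds (c.place J.1).mirror J.2.ends :=
    congrArg (fun K : Σ q, (c.chainStrip q).BoundaryInterval => K.2.ends) h
  obtain ⟨a, I⟩ := I
  obtain ⟨a', J⟩ := J
  dsimp only at h₁ h₂ h₃ hI hJ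
  rw [← facing_facing (c := c) a I.side] at hI
  rw [← facing_facing (c := c) a' J.side, ← h₂] at hJ
  obtain rfl : a = a' := eq_of_not_glued (Quotient.exact h₁) hI hJ
  exact congrArg _ (ModelStrip.BoundaryInterval.eq_of_side_eq (Side.act_injective _ h₂)
    (mirrorEnds_injective _ h₃))

theorem isFull_of_outer {I : Z.Interval} {hI : ¬ c.Glued I.1 I.2.side}
    (h : (c.outer I hI).2.IsFull) : I.2.IsFull := fun p hp =>
  mirrorEnds_injective (c.place I.1).mirror
    (h _ ⟨⟨I.1, I.2.side, p, hp⟩, rfl, hI, rfl, rfl⟩)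

theorem not_glued_X {b : Z.B} (hb : b ∉ c.D) : ¬ c.Glued (Z.X b).1 (Z.X b).2.side := by
  intro h
  obtain ⟨J, b', hb', ⟨h, -⟩ | ⟨h, -⟩⟩ := exists_joined_of_glued h
  · exact hb (Z.X_injective h ▸ hb')
  · exact Z.X_ne_Y _ _ h

theorem not_glued_Y {b : Z.B} (hb : b ∉ c.D) : ¬ c.Glued (Z.Y b).1 (Z.Y b).2.side := by
  intro h
  obtain ⟨J, b', hb', ⟨h, -⟩ | ⟨h, -⟩⟩ := exists_joined_of_glued h
  · exact Z.X_ne_Y _ _ h.symm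
  · exact hb (Z.Y_injective h ▸ hb')

variable (c) in
/-- The surface obtained by replacing each chain by a single strip; the gluings within the chains
disappear. -/
noncomputable def merged : StrippedSurface.{u, v} where
  A := Quotient c.chainSetoid
  B := {b : Z.B // b ∉ c.D}
  strip := c.chainStrip
  X b := c.outer (Z.X b) (not_glued_X b.2)
  Y b := c.outer (Z.Y b) (not_glued_Y b.2)
  X_injective _ _ h := Subtype.ext (Z.X_injective (outer_injective h))
  Y_injective _ _ h := Subtype.ext (Z.Y_injective (outer_injective h))
  X_ne_Y _ _ h := Z.X_ne_Y _ _ (outer_injective h)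
  φ b := ((signEquiv (c.place (Z.Y b).1).mirror).trans (Z.φ b)).trans
    (signEquiv (c.place (Z.X b).1).mirror)
  φ_image b := by
    ext y
    have h := Set.ext_iff.mp (Z.φ_image b)
    simp only [mem_image] at h ⊢
    change _ ↔ y ∈ Ioo (mirrorEnds _ _).1 (mirrorEnds _ _).2
    rw [mem_Ioo_mirrorEnds, ← h]
    constructor
    · rintro ⟨x, hx, rfl⟩
      exact ⟨_, mem_Ioo_mirrorEnds.mp hx, (unit_mul_self_mul _ _).symm⟩
    · rintro ⟨x, hx, hxy⟩
      refine ⟨((c.place (Z.Y b).1).mirror : ℤ) * x, mem_Ioo_mirrorEnds.mpr ?_, ?_⟩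
      · rwa [unit_mul_self_mul]
      · simp only [AffineEquiv.trans_apply, signEquiv_apply, unit_mul_self_mul, hxy]

theorem toChain_mem_outer {a : Z.A} {I : (Z.strip a).BoundaryInterval} (hI : ¬ c.Glued a I.side)
    {p : ℝ × ℝ} : c.toChain a p ∈ (c.outer ⟨a, I⟩ hI).2.toSet ↔ p ∈ I.toSet := by
  have hI' := hI
  rw [← facing_facing (c := c) a I.side] at hI'
  have h₁ : c.bound a I.side = (c.facing a I.side).level := by
    rw [← bound_of_not_glued hI', facing_facing]
  have h₂ : (c.toChain a p).2 = (c.facing a I.side).level ↔ p.2 = I.side.level := by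
    constructor
    · intro h
      have : c.toChain a p = c.toChain a (p.1, I.side.level) := by
        ext
        · rfl
        · rw [toChain_snd_level, h, h₁]
      rw [toChain_injective a this]
    · intro h
      obtain ⟨x, t⟩ := p
      obtain rfl : t = _ := h
      rw [toChain_snd_level, h₁]
  have h₃ : (c.toChain a p).1 ∈ Ioo (mirrorEnds (c.place a).mirror I.ends).1
      (mirrorEnds (c.place a).mirror I.ends).2 ↔ p.1 ∈ Ioo I.ends.1 I.ends.2 := by
    rw [mem_Ioo_mirrorEnds, toChain, unit_mul_self_mul]
  exact and_congr h₃ h₂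

theorem toChain_mem_carrier {a : Z.A} {p : ℝ × ℝ} (hp : p ∈ c.straight a) :
    c.toChain a p ∈ (c.chainStrip (Quotient.mk _ a)).carrier := by
  rcases straight_cases hp with h | ⟨e, he, h⟩ | ⟨I, hI, h⟩
  · have := toChain_snd_mem_Ioo (c := c) (a := a) h
    exact Or.inl ⟨(neg_one_le_lo a).trans_lt this.1, this.2.trans_le (hi_le_one a)⟩
  · obtain ⟨x, t⟩ := p
    obtain rfl : t = _ := he
    left
    change (c.toChain a _).2 ∈ Ioo (-1 : ℝ) 1
    rw [toChain_snd_level]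
    exact bound_mem_Ioo h
  · exact (c.outer ⟨a, I⟩ hI).2.toSet_subset_carrier ((toChain_mem_outer hI).mpr h)

theorem toChain_mem_Icc {a : Z.A} {p : ℝ × ℝ} (hp : p ∈ c.straight a) :
    (c.toChain a p).2 ∈ Icc (c.lo a) (c.hi a) := by
  have key : ∀ e : Side, p.2 = e.level → (c.toChain a p).2 ∈ Icc (c.lo a) (c.hi a) := by
    intro e he
    obtain ⟨x, t⟩ := p
    obtain rfl : t = _ := he
    rw [toChain_snd_level]
    exact bound_mem_Icc a e
  rcases straight_cases hp with h | ⟨e, he, h⟩ | ⟨I, hI, h⟩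
  · exact Ioo_subset_Icc_self (toChain_snd_mem_Ioo h)
  · exact key e he
  · exact key _ h.2

/-- Every point of the band of `a` comes from the straightened strip `a`. -/
theorem ofChain_mem_straight {a : Z.A} {w : ℝ × ℝ}
    (hw : w ∈ (c.chainStrip (Quotient.mk _ a)).carrier) (hw' : w.2 ∈ Icc (c.lo a) (c.hi a)) :
    c.ofChain a w ∈ c.straight a := by
  rcases ofChain_snd_mem hw' with h | ⟨e, he, hwe⟩
  · exact mem_straight_of_mem_Ioo h
  by_cases hg : c.Glued a e
  · exact mem_straight_of_glued hg he
  obtain ⟨d, rfl⟩ := exists_eq_facing (c := c) a e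
  rw [bound_of_not_glued hg] at hwe
  rcases (ModelStrip.mem_carrier_iff _ w).mp hw with h | ⟨K, hK⟩
  · rw [hwe] at h
    cases d
    · exact absurd h.1 (lt_irrefl _)
    · exact absurd h.2 (lt_irrefl _)
  obtain ⟨⟨a', I⟩, hq, hI, hd, hp⟩ := K.mem
  have hdd : d = K.side := by
    apply Side.sign_injective
    have : d.level = K.side.level := hwe.symm.trans hK.2
    rw [Side.level_eq, Side.level_eq] at this
    exact Units.ext (by exact_mod_cast this)
  subst hdd
  have hI' := hI
  dsimp only at hq hI hd hp hI'
  rw [← facing_facing (c := c) a' I.side, hd] at hI'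
  obtain rfl : a' = a := eq_of_not_glued (Quotient.exact hq) hI' hg
  have hmem : w ∈ (c.outer ⟨a', I⟩ hI).2.toSet := by
    obtain ⟨hK₁, hK₂⟩ := hK
    rw [hp] at hK₁
    rw [← hd] at hK₂
    exact ⟨hK₁, hK₂⟩
  rw [← toChain_ofChain (c := c) a' w, toChain_mem_outer] at hmem
  exact mem_straight_of_not_glued hI hmem

/-- Every point of the strip that represents a chain lies in the band of some strip of the chain. -/
theorem exists_mem_band_of_mem_carrier {a : Z.A} {w : ℝ × ℝ}
    (hw : w ∈ (c.chainStrip (Quotient.mk _ a)).carrier) :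
    ∃ a', Quotient.mk c.chainSetoid a' = Quotient.mk _ a ∧ w.2 ∈ Icc (c.lo a') (c.hi a') := by
  rcases (ModelStrip.mem_carrier_iff _ w).mp hw with h | ⟨K, hK⟩
  · obtain ⟨a', h₁, h₂⟩ := exists_mem_band (c := c) a h
    exact ⟨a', Quotient.sound h₁, h₂⟩
  · obtain ⟨⟨a', I⟩, hq, hI, hd, -⟩ := K.mem
    refine ⟨a', hq, ?_⟩
    dsimp only at hI hd
    have hw2 : w.2 = K.side.level := hK.2
    rw [← facing_facing (c := c) a' I.side] at hI
    rw [hw2, ← hd, ← bound_of_not_glued hI]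
    exact bound_mem_Icc _ _

/-! ### The homeomorphism onto the merged surface -/

variable (c)

/-- The points of the strip `a` that come from a point of the straightened strip. -/
noncomputable def point (a : Z.A) (p : ℝ × ℝ) (hp : p ∈ c.straight a) : Z.Total :=
  ⟨a, c.spread a p, hp⟩

/-- The inverse of `spread` on a strip. -/
noncomputable def unspread (a : Z.A) (z : (Z.strip a).carrier) : ℝ × ℝ :=
  (isOpenEmbedding_spread a).toIsEmbedding.toHomeomorph.symm ⟨z, exists_spread_eq (c := c) z.2⟩

variable {c}

theorem continuous_unspread (a : Z.A) : Continuous (c.unspread a) :=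
  (Homeomorph.continuous _).comp (continuous_subtype_val.subtype_mk _)

theorem spread_unspread (a : Z.A) (z : (Z.strip a).carrier) :
    c.spread a (c.unspread a z) = z :=
  congrArg Subtype.val ((isOpenEmbedding_spread a).toIsEmbedding.toHomeomorph.apply_symm_apply
    ⟨z, exists_spread_eq (c := c) z.2⟩)

theorem unspread_mem (a : Z.A) (z : (Z.strip a).carrier) : c.unspread a z ∈ c.straight a := by
  rw [straight, mem_preimage, spread_unspread]
  exact z.2

variable (c) in
/-- The map that puts each strip into its place in the strip that represents its chain. -/
noncomputable def merge (z : Z.Total) : c.merged.Total :=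
  ⟨Quotient.mk _ z.1, c.toChain z.1 (c.unspread z.1 z.2), toChain_mem_carrier (unspread_mem _ _)⟩

theorem point_unspread (z : Z.Total) : c.point z.1 (c.unspread z.1 z.2) (unspread_mem _ _) = z :=
  Z.total_ext rfl (spread_unspread _ _)

theorem merge_point {a : Z.A} {p : ℝ × ℝ} (hp : p ∈ c.straight a) :
    c.merge (c.point a p hp) = ⟨Quotient.mk _ a, c.toChain a p, toChain_mem_carrier hp⟩ := by
  refine total_ext _ rfl ?_
  change c.toChain a _ = c.toChain a p
  congr 1
  exact (isOpenEmbedding_spread a).injective (spread_unspread (c := c) a ⟨_, hp⟩)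

theorem merge_ofChain {w : c.merged.Total} {a : Z.A} (ha : w.1 = Quotient.mk _ a)
    (hw : (w.2 : ℝ × ℝ).2 ∈ Icc (c.lo a) (c.hi a)) :
    ∃ hp, c.merge (c.point a (c.ofChain a w.2) hp) = w := by
  obtain ⟨q, w⟩ := w
  obtain rfl : q = _ := ha
  refine ⟨ofChain_mem_straight w.2 hw, ?_⟩
  rw [merge_point]
  exact total_ext _ rfl (toChain_ofChain _ _)

theorem continuous_merge : Continuous c.merge := by
  refine continuous_sigma fun a => ?_
  have h : Continuous fun z : (Z.strip a).carrier =>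
      (⟨c.toChain a (c.unspread a z), toChain_mem_carrier (unspread_mem _ _)⟩ :
        (c.merged.strip (Quotient.mk _ a)).carrier) :=
    ((continuous_toChain a).comp (continuous_unspread a)).subtype_mk _
  exact (continuous_sigmaMk (σ := fun q => (c.merged.strip q).carrier)).comp h

theorem merge_surjective : Function.Surjective c.merge := by
  intro w
  obtain ⟨a, ha⟩ := Quotient.exists_rep w.1
  obtain ⟨q, w⟩ := w
  obtain rfl : _ = q := ha
  obtain ⟨a', h₁, h₂⟩ := exists_mem_band_of_mem_carrier w.2
  obtain ⟨hp, h⟩ := merge_ofChain (w := ⟨_, w⟩) h₁.symm h₂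
  exact ⟨_, h⟩

variable (c) in
/-- The part of the merged surface that is occupied by the strip `a`. -/
def band (a : Z.A) : Set c.merged.Total :=
  {w | w.1 = Quotient.mk _ a ∧ (w.2 : ℝ × ℝ).2 ∈ Icc (c.lo a) (c.hi a)}

/-- Near a point of the band of `a` there are only points of this band and of the neighbouring ones;
the bands accumulate only at the missing ends of the strip. -/
theorem locallyFinite_band : LocallyFinite c.band := by
  intro w
  obtain ⟨z, rfl⟩ := merge_surjective w
  rw [← point_unspread (c := c) z]
  generalize c.unspread z.1 z.2 = p, unspread_mem (c := c) z.1 z.2 = hp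
  generalize z.1 = a at p hp
  rw [merge_point]
  have hcont : Continuous fun w : c.merged.Total => (w.2 : ℝ × ℝ).2 :=
    continuous_sigma fun q => continuous_snd.comp continuous_subtype_val
  have h₀ := toChain_mem_Icc hp
  let N₁ : Set c.merged.Total := {w | c.Glued a (c.facing a .lower) →
    squash ((c.place a).shift - 3) < (w.2 : ℝ × ℝ).2}
  let N₂ : Set c.merged.Total := {w | c.Glued a (c.facing a .upper) →
    (w.2 : ℝ × ℝ).2 < squash ((c.place a).shift + 3)}
  have hN₁ : IsOpen N₁ := by
    by_cases h : c.Glued a (c.facing a .lower)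
    · simpa only [N₁, h, true_imp_iff] using isOpen_lt continuous_const hcont
    · simp [N₁, h]
  have hN₂ : IsOpen N₂ := by
    by_cases h : c.Glued a (c.facing a .upper)
    · simpa only [N₂, h, true_imp_iff] using isOpen_lt hcont continuous_const
    · simp [N₂, h]
  let N₃ : Set c.merged.Total := range (Sigma.mk (Quotient.mk _ a))
  refine ⟨N₁ ∩ N₂ ∩ N₃, ((hN₁.inter hN₂).inter isOpen_range_sigmaMk).mem_nhds
    ⟨⟨fun h => ?_, fun h => ?_⟩, ⟨_, rfl⟩⟩, ?_⟩
  · rw [lo_of_glued h] at h₀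
    exact (squash_strictMono (by linarith)).trans_le h₀.1
  · rw [hi_of_glued h] at h₀
    exact h₀.2.trans_lt (squash_strictMono (by linarith))
  refine Set.Finite.of_finite_image (f := fun a' => (c.place a').shift)
    ((Set.finite_Icc ((c.place a).shift - 4) ((c.place a).shift + 4)).subset ?_) ?_
  · rintro _ ⟨a', ⟨w, ⟨hw₁, hw₂⟩, ⟨hw₃, hw₄⟩, ⟨y, rfl⟩⟩, rfl⟩
    have hq : c.chainSetoid a' a := Quotient.exact hw₁.symm
    rcases below_trichotomy hq with rfl | h | h
    · exact ⟨by simp, by simp⟩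
    · obtain ⟨_, h₂⟩ := h.2.1
      have h₁ := (hw₃ h₂.glued_right).trans_le hw₂.2
      obtain ⟨_, h₃⟩ := h.1
      rw [hi_of_glued h₃.glued_left, squash_strictMono.lt_iff_lt] at h₁
      have h₄ : (c.place a).shift < (c.place a').shift + 4 := by
        have : ((c.place a).shift : ℝ) < (c.place a').shift + 4 := by linarith
        exact_mod_cast this
      have := h.2.2.1
      constructor <;> dsimp only <;> omega
    · obtain ⟨_, h₂⟩ := h.1
      have h₁ := hw₂.1.trans_lt (hw₄ h₂.glued_left)
      obtain ⟨_, h₃⟩ := h.2.1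
      rw [lo_of_glued h₃.glued_right, squash_strictMono.lt_iff_lt] at h₁
      have h₄ : (c.place a').shift < (c.place a).shift + 4 := by
        have : ((c.place a').shift : ℝ) < (c.place a).shift + 4 := by linarith
        exact_mod_cast this
      have := h.2.2.1
      constructor <;> dsimp only <;> omega
  · rintro a₁ ⟨w₁, ⟨h₁, -⟩, -, ⟨y₁, rfl⟩⟩ a₂ ⟨w₂, ⟨h₂, -⟩, -, ⟨y₂, rfl⟩⟩ hs
    have hq : c.chainSetoid a₁ a₂ := Quotient.exact (h₁.symm.trans h₂)
    dsimp only at hs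
    rcases below_trichotomy hq with h | h | h
    · exact h
    · have := h.2.2.1
      omega
    · have := h.2.2.1
      omega

theorem isClosedMap_merge : IsClosedMap c.merge := by
  intro T hT
  have hunion : c.merge '' T = ⋃ a, c.merge '' (T ∩ {z | z.1 = a}) := by
    rw [← image_iUnion, ← inter_iUnion]
    congr 1
    ext z
    simp
  rw [hunion]
  refine (locallyFinite_band.subset fun a => ?_).isClosed_iUnion fun a => ?_
  · rintro _ ⟨z, ⟨-, rfl⟩, rfl⟩
    exact ⟨rfl, toChain_mem_Icc (unspread_mem _ _)⟩
  -- On the band of `a` the map has a continuous inverse.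
  let E : Set (c.merged.strip (Quotient.mk _ a)).carrier :=
    {w | (w : ℝ × ℝ).2 ∈ Icc (c.lo a) (c.hi a)}
  have hE : IsClosed E := isClosed_Icc.preimage (continuous_snd.comp continuous_subtype_val)
  let G : E → Z.Total := fun w => c.point a (c.ofChain a w.1) (ofChain_mem_straight w.1.2 w.2)
  have hG : Continuous G := by
    refine continuous_sigmaMk.comp (Continuous.subtype_mk ?_ _)
    exact (isOpenEmbedding_spread a).continuous.comp ((continuous_ofChain a).comp
      (continuous_subtype_val.comp continuous_subtype_val))
  have himage : c.merge '' (T ∩ {z | z.1 = a})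
      = Sigma.mk (β := fun q => (c.merged.strip q).carrier) (Quotient.mk _ a) ''
        (Subtype.val '' (G ⁻¹' T)) := by
    ext w
    constructor
    · rintro ⟨z, ⟨hz, rfl⟩, rfl⟩
      have h := unspread_mem (c := c) z.1 z.2
      refine ⟨⟨_, toChain_mem_carrier h⟩, ⟨⟨⟨_, toChain_mem_carrier h⟩, toChain_mem_Icc h⟩,
        ?_, rfl⟩, rfl⟩
      have : G ⟨⟨_, toChain_mem_carrier h⟩, toChain_mem_Icc h⟩ = z := by
        refine Z.total_ext rfl ?_
        change c.spread z.1 (c.ofChain z.1 (c.toChain z.1 _)) = _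
        rw [ofChain_toChain, spread_unspread]
      change G _ ∈ T
      rwa [this]
    · rintro ⟨_, ⟨w, hw, rfl⟩, rfl⟩
      refine ⟨G w, ⟨hw, rfl⟩, ?_⟩
      rw [merge_point]
      exact total_ext _ rfl (toChain_ofChain _ _)
  rw [himage]
  exact (Topology.IsClosedEmbedding.sigmaMk
    (σ := fun q => (c.merged.strip q).carrier)).isClosedMap _
    (hE.isClosedEmbedding_subtypeVal.isClosedMap _ (hT.preimage hG))

theorem Joined.mem_straight {I J : Z.Interval} (h : c.Joined I J) (x : ℝ) :
    (x, I.2.side.level) ∈ c.straight I.1 := mem_straight_of_glued h.glued rfl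

theorem Joined.exists_eq_point {I J : Z.Interval} (h : c.Joined I J) {z : Z.Total}
    (hz : z.1 = I.1) (hz' : (z.2 : ℝ × ℝ) ∈ I.2.toSet) :
    ∃ x, z = c.point I.1 (x, I.2.side.level) (h.mem_straight x) ∧
      (z.2 : ℝ × ℝ).1 = stretch I.2.ends x := by
  obtain ⟨x, hx⟩ := exists_stretch_eq hz'.1
  refine ⟨x, Z.total_ext hz ?_, hx.symm⟩
  change _ = c.spread I.1 (x, I.2.side.level)
  rw [h.spread_eq, hx]
  exact Prod.ext rfl hz'.2

theorem mirror_mul_eq {b : Z.B} (hb : b ∈ c.D) (x : ℝ) :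
    (((c.place (Z.Y b).1).mirror : ℤ) : ℝ) * x
      = ((c.place (Z.X b).1).mirror : ℤ) * ((affineSign (Z.φ b) : ℤ) * x) := by
  rw [c.compatible b hb]
  simp only [Placement.mul_mirror, offset]
  push_cast
  ring

/-- In the coordinates of the chain, a gluing within the chain is the identity. -/
theorem Joined.mk_eq {I J : Z.Interval} (h : c.Joined I J) {x y : ℝ}
    (hxy : (((c.place I.1).mirror : ℤ) : ℝ) * x = ((c.place J.1).mirror : ℤ) * y) :
    Quot.mk Z.Glue (c.point I.1 (x, I.2.side.level) (h.mem_straight x))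
      = Quot.mk Z.Glue (c.point J.1 (y, J.2.side.level) (h.symm.mem_straight y)) := by
  have key : ∀ b ∈ c.D, ∀ (h : c.Joined (Z.Y b) (Z.X b)) (x y : ℝ),
      (((c.place (Z.Y b).1).mirror : ℤ) : ℝ) * x = ((c.place (Z.X b).1).mirror : ℤ) * y →
      Quot.mk Z.Glue (c.point (Z.Y b).1 (x, (Z.Y b).2.side.level) (h.mem_straight x))
        = Quot.mk Z.Glue (c.point (Z.X b).1 (y, (Z.X b).2.side.level) (h.symm.mem_straight y)) := by
    intro b hb h x y hxy
    rw [mirror_mul_eq hb] at hxy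
    have hy : (affineSign (Z.φ b) : ℤ) * x = y := by
      rw [← unit_mul_self_mul (c.place (Z.X b).1).mirror y, ← hxy, unit_mul_self_mul]
    refine Quot.sound ⟨b, rfl, ?_, rfl, ?_⟩
    · change c.spread _ _ ∈ _
      rw [h.spread_eq]
      exact ⟨stretch_mem (Z.Y b).2.lt x, rfl⟩
    · change c.spread _ _ = (Z.φ b (c.spread _ _).1, _)
      rw [h.spread_eq, h.symm.spread_eq, affineEquiv_stretch (Z.Y b).2.lt (Z.φ_image b), hy]
  have h' := h
  obtain ⟨b, hb, ⟨rfl, rfl⟩ | ⟨rfl, rfl⟩⟩ := h'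
  · exact (key b hb h.symm y x hxy.symm).symm
  · exact key b hb h x y hxy

theorem Joined.merge_eq {I J : Z.Interval} (h : c.Joined I J) {x y : ℝ}
    (hxy : (((c.place I.1).mirror : ℤ) : ℝ) * x = ((c.place J.1).mirror : ℤ) * y) :
    c.merge (c.point I.1 (x, I.2.side.level) (h.mem_straight x))
      = c.merge (c.point J.1 (y, J.2.side.level) (h.symm.mem_straight y)) := by
  rw [merge_point, merge_point]
  refine total_ext _ (Quotient.sound h.equiv) (Prod.ext hxy ?_)
  change (c.toChain _ _).2 = (c.toChain _ _).2
  rw [toChain_snd_level, toChain_snd_level, h.bound_eq]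

theorem point_eq_iff_merge_eq {a : Z.A} {p q : ℝ × ℝ} {hp : p ∈ c.straight a}
    {hq : q ∈ c.straight a} :
    c.merge (c.point a p hp) = c.merge (c.point a q hq) ↔ p = q := by
  constructor
  · intro h
    rw [merge_point, merge_point] at h
    exact toChain_injective a (congrArg (fun w : c.merged.Total => (w.2 : ℝ × ℝ)) h)
  · rintro rfl
    rfl

/-- The bands of different strips meet at most in a line along which the strips are glued. -/
theorem mk_eq_of_merge_eq {z w : Z.Total} (h : c.merge z = c.merge w) :
    Quot.mk Z.Glue z = Quot.mk Z.Glue w := by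
  have key : ∀ z w : Z.Total, c.merge z = c.merge w → c.Below z.1 w.1 →
      Quot.mk Z.Glue z = Quot.mk Z.Glue w := by
    intro z w h hb
    have hz := toChain_mem_Icc (unspread_mem (c := c) z.1 z.2)
    have hw := toChain_mem_Icc (unspread_mem (c := c) w.1 w.2)
    have hzw : (c.toChain z.1 (c.unspread z.1 z.2)).2 = (c.toChain w.1 (c.unspread w.1 w.2)).2 :=
      congrArg (fun w : c.merged.Total => (w.2 : ℝ × ℝ).2) h
    have hle := hb.hi_le_lo
    have hab : c.Above z.1 w.1 := hb.above_of_le (hw.1.trans (hzw.symm.le.trans hz.2))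
    have hhi : (c.toChain z.1 (c.unspread z.1 z.2)).2 = c.hi z.1 :=
      le_antisymm hz.2 (hle.trans (hw.1.trans hzw.symm.le))
    obtain ⟨I, J, hIJ, hI, hJ, hs⟩ := hab
    have hside : I.2.side = c.facing z.1 .upper := by
      refine Side.sign_injective (mul_left_cancel (a := (c.place z.1).flip) ?_)
      rw [hs, flip_mul_sign_facing, Side.sign]
    -- The point `z` lies on the glued side, so it has a partner in the strip of `w`.
    have hz2 : (c.unspread z.1 z.2).2 = I.2.side.level := by
      have : c.toChain z.1 (c.unspread z.1 z.2) = c.toChain z.1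
          ((c.unspread z.1 z.2).1, I.2.side.level) := by
        ext
        · rfl
        · rw [toChain_snd_level, hhi, hside]
          rfl
      exact congrArg Prod.snd (toChain_injective _ this)
    have hz' : z = c.point I.1 ((c.unspread z.1 z.2).1, I.2.side.level) (hIJ.mem_straight _) := by
      have : ((c.unspread z.1 z.2).1, I.2.side.level) = c.unspread z.1 z.2 :=
        Prod.ext rfl hz2.symm
      refine Z.total_ext hI.symm ?_
      change _ = c.spread I.1 _
      rw [this, congrArg c.spread hI]
      exact (spread_unspread _ _).symm
    generalize (c.unspread z.1 z.2).1 = x at hz'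
    have hxy : (((c.place I.1).mirror : ℤ) : ℝ) * x = ((c.place J.1).mirror : ℤ) *
        (((c.place J.1).mirror : ℤ) * (((c.place I.1).mirror : ℤ) * x)) :=
      (unit_mul_self_mul _ _).symm
    have h₁ := hIJ.mk_eq hxy
    have h₂ := hIJ.merge_eq hxy
    rw [← hz'] at h₁ h₂
    rw [h₁]
    congr 1
    rw [h₂] at h
    obtain ⟨a, w⟩ := w
    obtain rfl : J.1 = a := hJ
    rw [← point_unspread (c := c) ⟨J.1, w⟩] at h ⊢
    have := point_eq_iff_merge_eq.mp h
    congr 1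
  have hq : c.chainSetoid z.1 w.1 :=
    Quotient.exact (congrArg (fun w : c.merged.Total => w.1) h)
  rcases below_trichotomy hq with hzw | hzw | hzw
  · congr 1
    obtain ⟨a, z⟩ := z
    obtain ⟨a', w⟩ := w
    obtain rfl : a = a' := hzw
    rw [← point_unspread (c := c) ⟨a, z⟩, ← point_unspread (c := c) ⟨a, w⟩] at h ⊢
    have := point_eq_iff_merge_eq.mp h
    congr 1
  · exact key z w h hzw
  · exact (key w z h.symm hzw).symm

theorem exists_eq_point_of_not_glued {I : Z.Interval} (hI : ¬ c.Glued I.1 I.2.side) {z : Z.Total}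
    (hz : z.1 = I.1) (hz' : (z.2 : ℝ × ℝ) ∈ I.2.toSet) :
    z = c.point I.1 z.2 (mem_straight_of_not_glued hI hz') :=
  Z.total_ext hz (spread_eq_self hI hz').symm

/-- A gluing that is not within a chain glues the same points in the merged surface. -/
theorem merged_glue {b : Z.B} (hb : b ∉ c.D) (p : ℝ × ℝ) :
    ((c.merged.φ ⟨b, hb⟩ (c.toChain (Z.Y b).1 p).1,
      (c.merged.X ⟨b, hb⟩).2.side.level) : ℝ × ℝ)
      = c.toChain (Z.X b).1 (Z.φ b p.1, (Z.X b).2.side.level) := by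
  ext
  · change signEquiv _ (Z.φ b (signEquiv _ _)) = _
    simp only [signEquiv_apply, toChain, unit_mul_self_mul]
  · have h := not_glued_X hb
    rw [← facing_facing (c := c) (Z.X b).1 (Z.X b).2.side] at h
    rw [toChain_snd_level, ← facing_facing (c := c) (Z.X b).1 (Z.X b).2.side,
      bound_of_not_glued h]
    rfl

theorem φ_mem {b : Z.B} {p : ℝ × ℝ} (hp : p ∈ (Z.Y b).2.toSet) :
    (Z.φ b p.1, (Z.X b).2.side.level) ∈ (Z.X b).2.toSet :=
  ⟨Z.φ_image b ▸ mem_image_of_mem _ hp.1, rfl⟩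

theorem mk_merge_eq_of_glue {z w : Z.Total} (h : Z.Glue z w) :
    Quot.mk c.merged.Glue (c.merge z) = Quot.mk c.merged.Glue (c.merge w) := by
  obtain ⟨b, hz, hz', hw, hw'⟩ := h
  have hwm : (w.2 : ℝ × ℝ) ∈ (Z.X b).2.toSet := hw' ▸ φ_mem hz'
  by_cases hb : b ∈ c.D
  · have hj : c.Joined (Z.Y b) (Z.X b) := ⟨b, hb, Or.inr ⟨rfl, rfl⟩⟩
    obtain ⟨x, hzx, hx⟩ := hj.exists_eq_point hz hz'
    obtain ⟨y, hwy, hy⟩ := hj.symm.exists_eq_point hw hwm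
    rw [hw', hx] at hy
    dsimp only at hy
    rw [affineEquiv_stretch (Z.Y b).2.lt (Z.φ_image b)] at hy
    have hxy := (stretch_strictMono (Z.X b).2.lt).injective hy
    rw [hzx, hwy, hj.merge_eq (by rw [mirror_mul_eq hb, hxy])]
  · rw [exists_eq_point_of_not_glued (not_glued_Y hb) hz hz',
      exists_eq_point_of_not_glued (not_glued_X hb) hw hwm, merge_point, merge_point]
    refine Quot.sound ⟨⟨b, hb⟩, rfl, (toChain_mem_outer (not_glued_Y hb)).mpr hz', rfl, ?_⟩
    rw [merged_glue hb, ← hw']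

theorem mk_eq_of_glue_merge {z w : Z.Total} (h : c.merged.Glue (c.merge z) (c.merge w)) :
    Quot.mk Z.Glue z = Quot.mk Z.Glue w := by
  obtain ⟨⟨b, hb⟩, hz, hz', hw, hw'⟩ := h
  have hm : ((c.merge z).2 : ℝ × ℝ) ∈ (c.outer (Z.Y b) (not_glued_Y hb)).2.toSet := hz'
  rw [← toChain_ofChain (c := c) (Z.Y b).1 (c.merge z).2,
    toChain_mem_outer (not_glued_Y hb)] at hm
  set p := c.ofChain (Z.Y b).1 (c.merge z).2
  have hp : c.toChain (Z.Y b).1 p = (c.merge z).2 := toChain_ofChain _ _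
  have h₁ : c.merge z = c.merge (c.point _ p (mem_straight_of_not_glued (not_glued_Y hb) hm)) := by
    rw [merge_point]
    exact total_ext _ hz hp.symm
  rw [← hp, merged_glue hb] at hw'
  have h₂ : c.merge w = c.merge (c.point _ _ (mem_straight_of_not_glued (not_glued_X hb)
      (φ_mem hm))) := by
    rw [merge_point]
    exact total_ext _ hw hw'
  rw [mk_eq_of_merge_eq h₁, mk_eq_of_merge_eq h₂]
  refine Quot.sound ⟨b, rfl, ?_, rfl, ?_⟩
  · change c.spread _ _ ∈ _
    rwa [spread_eq_self (not_glued_Y hb) hm]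
  · change c.spread _ _ = (Z.φ b (c.spread _ _).1, _)
    rw [spread_eq_self (not_glued_Y hb) hm, spread_eq_self (not_glued_X hb) (φ_mem hm)]

theorem merge_image_slice {a : Z.A} {l l' : Set (ℝ × ℝ)}
    (h : ∀ p ∈ c.straight a, c.spread a p ∈ l → c.toChain a p ∈ l')
    (h' : ∀ w ∈ l', c.ofChain a w ∈ c.straight a ∧ c.spread a (c.ofChain a w) ∈ l) :
    c.merge '' Z.slice a l = c.merged.slice (Quotient.mk _ a) l' := by
  ext w
  constructor
  · rintro ⟨z, ⟨rfl, hz⟩, rfl⟩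
    refine ⟨rfl, h _ (unspread_mem _ _) ?_⟩
    rwa [spread_unspread]
  · rintro ⟨hw, hwl⟩
    obtain ⟨h₁, h₂⟩ := h' _ hwl
    refine ⟨c.point a _ h₁, ⟨rfl, h₂⟩, ?_⟩
    rw [merge_point]
    exact total_ext _ hw.symm (toChain_ofChain _ _)

theorem merge_image_leaf (a : Z.A) {l : Set (ℝ × ℝ)} (hl : l ∈ (Z.strip a).leaves) :
    ∃ l' ∈ (c.merged.strip (Quotient.mk _ a)).leaves,
      c.merge '' Z.slice a l = c.merged.slice (Quotient.mk _ a) l' := by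
  -- Lines at a given height correspond to lines.
  have key : ∀ t s : ℝ, (∀ x, (c.toChain a (x, t)).2 = s) → (∀ x, (x, t) ∈ c.straight a) →
      (∀ x, c.spread a (x, t) ∈ l) → (∀ p, c.spread a p ∈ l → p.2 = t) →
      c.merge '' Z.slice a l = c.merged.slice (Quotient.mk _ a) (univ ×ˢ {s}) := by
    intro t s h₁ h₂ h₃ h₄
    refine merge_image_slice ?_ ?_
    · rintro ⟨x, t'⟩ - hp
      obtain rfl : t' = t := h₄ _ hp
      exact ⟨mem_univ _, h₁ x⟩
    · rintro ⟨y, s'⟩ ⟨-, rfl : s' = s⟩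
      have : c.ofChain a (y, s') = (((c.place a).mirror : ℤ) * y, t) := by
        apply toChain_injective (c := c) a
        rw [toChain_ofChain]
        exact Prod.ext (unit_mul_self_mul _ _).symm (h₁ _).symm
      rw [this]
      exact ⟨h₂ _, h₃ _⟩
  rcases hl with ⟨t, ht, rfl⟩ | ⟨I, rfl⟩
  · refine ⟨univ ×ˢ {(c.toChain a (0, t)).2}, Or.inl ⟨_, ?_, rfl⟩, ?_⟩
    · have := toChain_snd_mem_Ioo (c := c) (a := a) (p := (0, t)) ht
      exact ⟨(neg_one_le_lo a).trans_lt this.1, this.2.trans_le (hi_le_one a)⟩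
    · exact key t _ (fun _ => rfl) (fun _ => mem_straight_of_mem_Ioo ht)
        (fun _ => ⟨mem_univ _, rfl⟩) fun _ hp => hp.2
  by_cases hg : c.Glued a I.side
  · obtain ⟨J, hJ⟩ := exists_joined_of_glued (I := ⟨a, I⟩) hg
    refine ⟨univ ×ˢ {c.bound a I.side}, Or.inl ⟨_, bound_mem_Ioo hg, rfl⟩, ?_⟩
    refine key I.side.level _ (fun x => toChain_snd_level a x _) hJ.mem_straight (fun x => ?_)
      fun _ hp => hp.2
    rw [hJ.spread_eq]
    exact ⟨stretch_mem I.lt x, rfl⟩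
  · refine ⟨(c.outer ⟨a, I⟩ hg).2.toSet, Or.inr ⟨_, rfl⟩, merge_image_slice ?_ ?_⟩
    · intro p hp hpI
      rw [toChain_mem_outer hg]
      obtain ⟨x, t⟩ := p
      obtain rfl : t = I.side.level := hpI.2
      rwa [spread_level, profile_of_not_glued hg] at hpI
    · intro w hw
      rw [← toChain_ofChain (c := c) a w, toChain_mem_outer hg] at hw
      refine ⟨mem_straight_of_not_glued hg hw, ?_⟩
      rwa [spread_eq_self hg hw]

variable (c) in
theorem fHomeomorphic_merged : Z.FHomeomorphic c.merged :=
  .of_isClosedMap continuous_merge isClosedMap_merge merge_surjective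
    (fun _ _ => mk_merge_eq_of_glue) (fun _ _ => mk_eq_of_merge_eq)
    (fun _ _ => mk_eq_of_glue_merge) fun a _ hl => ⟨_, merge_image_leaf a hl⟩

end StrippedSurface.ChainDatum

/-! ### Surfaces made of one strip with both sides glued together -/

section rectify

variable (P Q : ℝ × ℝ) (y : ℤˣ)

/-- The weight of the interval `Q` at height `t`: it is `0` for `t = -y` and `1` for `t = y`. -/
noncomputable def sideWeight (t : ℝ) : ℝ := ramp ((1 + (y : ℤ) * t) / 2)

/-- The midpoint of the interval at height `t`, between `P` and `Q`. -/
noncomputable def centerAt (t : ℝ) : ℝ :=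
  (1 - sideWeight y t) * ((P.1 + P.2) / 2) + sideWeight y t * ((Q.1 + Q.2) / 2)

/-- The length of the interval at height `t`, between `P` and `Q`. -/
noncomputable def lengthAt (t : ℝ) : ℝ :=
  (1 - sideWeight y t) * (P.2 - P.1) + sideWeight y t * (Q.2 - Q.1)

variable {P Q}

theorem continuous_sideWeight : Continuous (sideWeight y) :=
  continuous_ramp.comp (by fun_prop)

theorem lengthAt_pos (hP : P.1 < P.2) (hQ : Q.1 < Q.2) (t : ℝ) : 0 < lengthAt P Q y t := by
  have h₁ : 0 ≤ sideWeight y t := ramp_nonneg _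
  have h₂ : sideWeight y t ≤ 1 := max_le zero_le_one (min_le_right _ _)
  have hP' := sub_pos.mpr hP
  have hQ' := sub_pos.mpr hQ
  have := mul_nonneg (sub_nonneg.mpr h₂) hP'.le
  have := mul_nonneg h₁ hQ'.le
  unfold lengthAt
  rcases h₁.eq_or_lt with h | h
  · rw [← h] at *
    linarith
  · have := mul_pos h hQ'
    linarith

/-- A homeomorphism of the plane that is affine on horizontal lines, maps the interval `P` at height
`-y` to `(-2, 2)` at height `-1` and the interval `Q` at height `y` to `(-2, 2)` at height `1`. -/
noncomputable def rectify (hP : P.1 < P.2) (hQ : Q.1 < Q.2) : ℝ × ℝ ≃ₜ ℝ × ℝ where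
  toFun p := (4 * (p.1 - centerAt P Q y p.2) / lengthAt P Q y p.2, (y : ℤ) * p.2)
  invFun w := (centerAt P Q y ((y : ℤ) * w.2) + lengthAt P Q y ((y : ℤ) * w.2) * w.1 / 4,
    (y : ℤ) * w.2)
  left_inv p := by
    have := (lengthAt_pos y hP hQ p.2).ne'
    ext
    · simp only [unit_mul_self_mul]
      field_simp
      ring
    · exact unit_mul_self_mul _ _
  right_inv w := by
    have := (lengthAt_pos y hP hQ ((y : ℤ) * w.2)).ne'
    ext
    · dsimp only
      field_simp
      ring
    · exact unit_mul_self_mul _ _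
  continuous_toFun := by
    have h := continuous_sideWeight y
    refine Continuous.prodMk (Continuous.div ?_ ?_ fun p => (lengthAt_pos y hP hQ p.2).ne')
      (by fun_prop)
    · unfold centerAt
      fun_prop
    · unfold lengthAt
      fun_prop
  continuous_invFun := by
    have h := continuous_sideWeight y
    unfold centerAt lengthAt
    fun_prop

variable {y} (hP : P.1 < P.2) (hQ : Q.1 < Q.2)

theorem rectify_lower {t : ℝ} (ht : (y : ℤ) * t = -1) (x : ℝ) :
    rectify y hP hQ (x, t) = (4 * (x - (P.1 + P.2) / 2) / (P.2 - P.1), -1) := by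
  have : sideWeight y t = 0 := by simp [sideWeight, ht, ramp]
  refine Prod.ext ?_ ht
  simp [rectify, centerAt, lengthAt, this]

theorem rectify_upper {t : ℝ} (ht : (y : ℤ) * t = 1) (x : ℝ) :
    rectify y hP hQ (x, t) = (4 * (x - (Q.1 + Q.2) / 2) / (Q.2 - Q.1), 1) := by
  have : sideWeight y t = 1 := by simp [sideWeight, ht, ramp]
  refine Prod.ext ?_ ht
  simp [rectify, centerAt, lengthAt, this]

theorem affine_mem_Ioo_iff {R : ℝ × ℝ} (hR : R.1 < R.2) (x : ℝ) :
    4 * (x - (R.1 + R.2) / 2) / (R.2 - R.1) ∈ Ioo (-2 : ℝ) 2 ↔ x ∈ Ioo R.1 R.2 := by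
  have := sub_pos.mpr hR
  rw [mem_Ioo, mem_Ioo, lt_div_iff₀ this, div_lt_iff₀ this]
  constructor <;> rintro ⟨h₁, h₂⟩ <;> constructor <;> linarith

end rectify

namespace StrippedSurface

variable {Z : StrippedSurface.{u, v}} {b : Z.B}

/-- If the two sides of a strip are glued together along their only boundary intervals, these are on
opposite sides. -/
theorem side_ne_of_isFull (hX : (Z.X b).2.IsFull) (h : (Z.X b).1 = (Z.Y b).1) :
    (Z.X b).2.side ≠ (Z.Y b).2.side := by
  intro hs
  apply Z.X_ne_Y b b
  generalize Z.X b = I at *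
  generalize Z.Y b = J at *
  obtain ⟨a, I⟩ := I
  obtain ⟨a', J⟩ := J
  obtain rfl : a = a' := h
  exact congrArg _ (hX.eq hs.symm).symm

theorem eq_X_or_eq_Y (hX : (Z.X b).2.IsFull) (hY : (Z.Y b).2.IsFull) (h : (Z.X b).1 = (Z.Y b).1)
    (I : Z.Interval) (hI : I.1 = (Z.X b).1) : I = Z.X b ∨ I = Z.Y b := by
  have hs := side_ne_of_isFull hX h
  generalize Z.X b = K at *
  generalize Z.Y b = J at *
  obtain ⟨a, K⟩ := K
  obtain ⟨a', J⟩ := J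
  obtain ⟨a'', I⟩ := I
  obtain rfl : a = a' := h
  obtain rfl : a'' = a := hI
  have : I.side = K.side ∨ I.side = J.side := by
    dsimp only at hs
    generalize I.side = e at *
    generalize K.side = e₁ at *
    generalize J.side = e₂ at *
    cases e <;> cases e₁ <;> cases e₂ <;> simp_all
  exact this.imp (fun h => congrArg _ (hX.eq h)) fun h => congrArg _ (hY.eq h)

/-- A strip with both sides glued together is open and closed in the surface. -/
theorem eq_of_connectedSpace [ConnectedSpace Z.Space] (hX : (Z.X b).2.IsFull)
    (hY : (Z.Y b).2.IsFull) (h : (Z.X b).1 = (Z.Y b).1) (a : Z.A) : a = (Z.X b).1 := by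
  have hglue : ∀ z w, Z.Glue z w → (z.1 = (Z.X b).1) = (w.1 = (Z.X b).1) := by
    rintro z w ⟨b', hz, -, hw, -⟩
    rw [hz, hw]
    apply propext
    constructor <;> intro h'
    · rcases eq_X_or_eq_Y hX hY h _ h' with h'' | h''
      · exact absurd h''.symm (Z.X_ne_Y _ _)
      · rw [Z.Y_injective h'']
    · rcases eq_X_or_eq_Y hX hY h _ h' with h'' | h''
      · rw [Z.X_injective h'', h]
      · exact absurd h'' (Z.X_ne_Y _ _)
  let U : Set Z.Space := {q | Quot.lift (fun z : Z.Total => z.1 = (Z.X b).1) hglue q}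
  have hpre : Quot.mk Z.Glue ⁻¹' U = range (Sigma.mk (Z.X b).1) := by
    ext ⟨a, z⟩
    constructor
    · rintro (rfl : a = _)
      exact ⟨z, rfl⟩
    · rintro ⟨z', h⟩
      exact (congrArg Sigma.fst h).symm
  have hclopen : IsClopen U := by
    rw [← isQuotientMap_quot_mk.isClopen_preimage, hpre]
    exact ⟨Topology.IsClosedEmbedding.sigmaMk.isClosed_range, isOpen_range_sigmaMk⟩
  have hmem : ∀ a, (0, 0) ∈ (Z.strip a).carrier := fun a => Or.inl ⟨by norm_num, by norm_num⟩
  have hU : U = univ := hclopen.eq_univ ⟨Quot.mk _ ⟨(Z.X b).1, (0, 0), hmem _⟩, rfl⟩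
  exact eq_univ_iff_forall.mp hU (Quot.mk _ ⟨a, (0, 0), hmem a⟩)

theorem mem_rectangleStrip_iff (w : ℝ × ℝ) : w ∈ rectangleStrip.carrier ↔
    w.2 ∈ Ioo (-1 : ℝ) 1 ∨ ∃ e, w ∈ (rectangleSide e).toSet := by
  rw [ModelStrip.mem_carrier_iff]
  refine or_congr_right ⟨?_, fun ⟨e, h⟩ => ⟨_, h⟩⟩
  rintro ⟨⟨e, p, hp⟩, h⟩
  obtain rfl : p = (-2, 2) := hp
  exact ⟨e, h⟩

theorem fHomeomorphic_rectangleGlue [ConnectedSpace Z.Space] (hX : (Z.X b).2.IsFull)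
    (hY : (Z.Y b).2.IsFull) (h : (Z.X b).1 = (Z.Y b).1) {f : ℝ ≃ᵃ[ℝ] ℝ}
    (hf : f '' Ioo (-2) 2 = Ioo (-2) 2) (hfφ : ∀ x, f x = (affineSign (Z.φ b) : ℤ) * x) :
    Z.FHomeomorphic (rectangleGlue f hf) := by
  have hone : ∀ a a' : Z.A, a = a' := fun a a' =>
    (eq_of_connectedSpace hX hY h a).trans (eq_of_connectedSpace hX hY h a').symm
  have hcases : ∀ I : Z.Interval, I = Z.X b ∨ I = Z.Y b := fun I =>
    eq_X_or_eq_Y hX hY h I (hone _ _)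
  have hb : ∀ b', b' = b := fun b' =>
    (hcases (Z.Y b')).elim (fun h => absurd h.symm (Z.X_ne_Y _ _)) fun h => Z.Y_injective h
  -- The strip is turned so that the side of `X b` becomes the lower one.
  let y : ℤˣ := -(Z.X b).2.side.sign
  let Ψ := rectify y (Z.X b).2.lt (Z.Y b).2.lt
  have hXl : ((y : ℤ) : ℝ) * (Z.X b).2.side.level = -1 := by
    rw [Side.level_eq, ← Int.cast_mul, ← Units.val_mul, neg_mul, Int.units_mul_self]
    simp
  have hYl : ((y : ℤ) : ℝ) * (Z.Y b).2.side.level = 1 := by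
    have hs := side_ne_of_isFull hX h
    rw [Side.level_eq, ← Int.cast_mul, ← Units.val_mul]
    simp only [y]
    generalize (Z.X b).2.side = e₁ at *
    generalize (Z.Y b).2.side = e₂ at *
    cases e₁ <;> cases e₂ <;> simp_all [Side.sign]
  have hy : ∀ {s t : ℝ}, ((y : ℤ) : ℝ) * s = (y : ℤ) * t → s = t := fun {s t} h => by
    rw [← unit_mul_self_mul y s, h, unit_mul_self_mul]
  have hX' : ∀ p, Ψ p ∈ (rectangleSide .lower).toSet ↔ p ∈ (Z.X b).2.toSet := by
    rintro ⟨x, t⟩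
    by_cases ht : t = (Z.X b).2.side.level
    · subst ht
      rw [show Ψ _ = _ from rectify_lower _ _ hXl x]
      exact and_congr (affine_mem_Ioo_iff (Z.X b).2.lt x) ⟨fun _ => rfl, fun _ => rfl⟩
    · exact iff_of_false (fun h => ht (hy (h.2.trans hXl.symm))) fun h => ht h.2
  have hY' : ∀ p, Ψ p ∈ (rectangleSide .upper).toSet ↔ p ∈ (Z.Y b).2.toSet := by
    rintro ⟨x, t⟩
    by_cases ht : t = (Z.Y b).2.side.level
    · subst ht
      rw [show Ψ _ = _ from rectify_upper _ _ hYl x]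
      exact and_congr (affine_mem_Ioo_iff (Z.Y b).2.lt x) ⟨fun _ => rfl, fun _ => rfl⟩
    · exact iff_of_false (fun h => ht (hy (h.2.trans hYl.symm))) fun h => ht h.2
  have hinner : ∀ p, (Ψ p).2 ∈ Ioo (-1 : ℝ) 1 ↔ p.2 ∈ Ioo (-1 : ℝ) 1 := by
    intro p
    rw [show (Ψ p).2 = (y : ℤ) * p.2 from rfl]
    rcases Int.units_eq_one_or y with hy | hy <;> rw [hy] <;> push_cast
    · rw [one_mul]
    · constructor <;> rintro ⟨h₁, h₂⟩ <;> constructor <;> linarith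
  have hmem : ∀ a p, Ψ p ∈ rectangleStrip.carrier ↔ p ∈ (Z.strip a).carrier := by
    intro a p
    rw [mem_rectangleStrip_iff, ModelStrip.mem_carrier_iff, hinner]
    refine or_congr_right ?_
    have hXa : ∃ I : (Z.strip a).BoundaryInterval, I.toSet = (Z.X b).2.toSet := by
      rw [hone a (Z.X b).1]
      exact ⟨_, rfl⟩
    have hYa : ∃ I : (Z.strip a).BoundaryInterval, I.toSet = (Z.Y b).2.toSet := by
      rw [hone a (Z.Y b).1]
      exact ⟨_, rfl⟩
    constructor
    · rintro ⟨e | e, he⟩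
      · obtain ⟨I, hI⟩ := hXa
        exact ⟨I, hI ▸ (hX' p).mp he⟩
      · obtain ⟨I, hI⟩ := hYa
        exact ⟨I, hI ▸ (hY' p).mp he⟩
    · rintro ⟨I, hI⟩
      have hI' : p ∈ (⟨a, I⟩ : Z.Interval).2.toSet := hI
      rcases hcases ⟨a, I⟩ with h | h <;> rw [h] at hI'
      · exact ⟨_, (hX' p).mpr hI'⟩
      · exact ⟨_, (hY' p).mpr hI'⟩
  let C := rectangleGlue f hf
  let F : Z.Total ≃ₜ C.Total :=
    { toFun := fun z => ⟨(), Ψ z.2, (hmem z.1 _).mpr z.2.2⟩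
      invFun := fun w => ⟨(Z.X b).1, Ψ.symm w.2, (hmem _ _).mp (by
        rw [Ψ.apply_symm_apply]
        exact w.2.2)⟩
      left_inv := fun z => Z.total_ext (hone _ _) (Ψ.symm_apply_apply _)
      right_inv := fun w => C.total_ext rfl (Ψ.apply_symm_apply _)
      continuous_toFun := by
        refine continuous_sigma fun a => ?_
        exact (continuous_sigmaMk (σ := fun q => (C.strip q).carrier) (i := ())).comp
          ((Ψ.continuous.comp continuous_subtype_val).subtype_mk _)
      continuous_invFun := by
        refine continuous_sigma fun _ => ?_
        exact (continuous_sigmaMk (σ := fun a => (Z.strip a).carrier)).comp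
          ((Ψ.symm.continuous.comp continuous_subtype_val).subtype_mk _) }
  have hφ : ∀ p ∈ (Z.Y b).2.toSet, Ψ (Z.φ b p.1, (Z.X b).2.side.level)
      = (f (Ψ p).1, Side.lower.level) := by
    rintro ⟨x, t⟩ ⟨-, rfl : t = _⟩
    have h₁ := sub_pos.mpr (Z.X b).2.lt
    have h₂ := sub_pos.mpr (Z.Y b).2.lt
    rw [show Ψ _ = _ from rectify_lower _ _ hXl _, show Ψ _ = _ from rectify_upper _ _ hYl x, hfφ,
      affineEquiv_eq_of_image_Ioo (Z.Y b).2.lt (Z.φ_image b)]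
    refine Prod.ext ?_ rfl
    dsimp only
    field_simp
    ring
  have hglue : ∀ z w, Z.Glue z w ↔ C.Glue (F z) (F w) := by
    intro z w
    constructor
    · rintro ⟨b', -, hz, -, hw⟩
      rw [hb b'] at hz hw
      refine ⟨(), rfl, (hY' _).mpr hz, rfl, ?_⟩
      change Ψ w.2 = (f (Ψ z.2).1, Side.lower.level)
      rw [← hφ _ hz, ← hw]
    · rintro ⟨_, -, hz, -, hw⟩
      have hz' := (hY' _).mp hz
      refine ⟨b, hone _ _, hz', hone _ _, Ψ.injective ?_⟩
      rw [hφ _ hz']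
      exact hw
  have hslice : ∀ a l l', (∀ p, Ψ p ∈ l' ↔ p ∈ l) → F '' Z.slice a l = C.slice () l' := by
    intro a l l' hl
    ext w
    constructor
    · rintro ⟨z, ⟨-, hz⟩, rfl⟩
      exact ⟨rfl, (hl _).mpr hz⟩
    · rintro ⟨-, hw⟩
      obtain ⟨z, rfl⟩ := F.surjective w
      exact ⟨z, ⟨hone _ _, (hl _).mp hw⟩, rfl⟩
  refine .of_isClosedMap F.continuous F.isClosedMap F.surjective
    (fun z w hzw => Quot.sound ((hglue z w).mp hzw)) (fun z w hzw => by rw [F.injective hzw])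
    (fun z w hzw => Quot.sound ((hglue z w).mpr hzw)) ?_
  rintro a l (⟨t, ht, rfl⟩ | ⟨I, rfl⟩)
  · refine ⟨(), univ ×ˢ {((y : ℤ) : ℝ) * t}, Or.inl ⟨_, ?_, rfl⟩, hslice _ _ _ fun p => ?_⟩
    · exact (hinner (0, t)).mpr ht
    · exact and_congr Iff.rfl ⟨fun h => hy h, fun h => congrArg _ h⟩
  · have hI : ∃ e, ∀ p, Ψ p ∈ (rectangleSide e).toSet ↔ p ∈ (⟨a, I⟩ : Z.Interval).2.toSet := by
      rcases hcases ⟨a, I⟩ with h | h <;> rw [h]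
      · exact ⟨_, hX'⟩
      · exact ⟨_, hY'⟩
    obtain ⟨e, he⟩ := hI
    exact ⟨(), _, Or.inr ⟨rectangleSide e, rfl⟩, hslice _ _ _ he⟩

/-- A connected surface in which both sides of a strip are glued together is a cylinder or a Möbius
band, according to the sign of the gluing map. -/
theorem fHomeomorphic_cylinderC_or_moebiusM [ConnectedSpace Z.Space] (hX : (Z.X b).2.IsFull)
    (hY : (Z.Y b).2.IsFull) (h : (Z.X b).1 = (Z.Y b).1) :
    Z.FHomeomorphic cylinderC ∨ Z.FHomeomorphic moebiusM := by
  rcases Int.units_eq_one_or (affineSign (Z.φ b)) with hs | hs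
  · left
    refine fHomeomorphic_rectangleGlue hX hY h _ fun x => ?_
    rw [hs]
    simp
  · right
    refine fHomeomorphic_rectangleGlue hX hY h _ fun x => ?_
    rw [hs]
    simp

end StrippedSurface

/-! ### Reduction -/

theorem mainTheorem3 (Z : StrippedSurface.{u, v}) (hconn : ConnectedSpace Z.Space)
    (hbase : SecondCountableTopology Z.Space) :
    Z.FHomeomorphic cylinderC ∨ Z.FHomeomorphic moebiusM ∨
      ∃ Z' : StrippedSurface.{u, v}, Z'.IsReduced ∧ Z.FHomeomorphic Z' := by
  obtain ⟨c, hc⟩ := Z.exists_chainDatum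
  have hZ := c.fHomeomorphic_merged
  have hconn' : ConnectedSpace c.merged.Space := by
    obtain ⟨e, -⟩ := hZ
    exact e.surjective.connectedSpace e.continuous
  -- By maximality, a gluing of full intervals in the merged surface joins a strip to itself.
  have hsame : ∀ b : c.merged.B, (c.merged.X b).2.IsFull → (c.merged.Y b).2.IsFull →
      (c.merged.X b).1 = (c.merged.Y b).1 := fun b hX hY =>
    Quotient.sound (hc b.1
      (StrippedSurface.ChainDatum.isFull_of_outer
        (hI := StrippedSurface.ChainDatum.not_glued_X b.2) hX)
      (StrippedSurface.ChainDatum.isFull_of_outer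
        (hI := StrippedSurface.ChainDatum.not_glued_Y b.2) hY))
  by_cases hred : c.merged.IsReduced
  · exact Or.inr (Or.inr ⟨_, hred, hZ⟩)
  have hfull : ∃ b : c.merged.B, (c.merged.X b).2.IsFull ∧ (c.merged.Y b).2.IsFull := by
    by_contra hno
    refine hred fun w _ => ⟨?_, ?_⟩ <;> rintro ⟨b, -, -, hX, hY⟩ <;>
      exact hno ⟨b, ModelStrip.BoundaryInterval.isFull_of_toSet_eq _ hX,
        ModelStrip.BoundaryInterval.isFull_of_toSet_eq _ hY⟩
  obtain ⟨b, hX, hY⟩ := hfull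
  rcases StrippedSurface.fHomeomorphic_cylinderC_or_moebiusM hX hY (hsame b hX hY) with h | h
  · exact Or.inl (hZ.trans h)
  · exact Or.inr (Or.inl (hZ.trans h))
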